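/- Let $J$ be a metric tree: a connected graph without circuits, with a countable set $\mathrm{Vert}(J)$ of vertices and a positive length assigned to each edge; $\rho$ is the path metric on $\mathrm{Vert}(J)$. Assume that $J$ is perfect (each vertex belongs to at least $3$ edges) and locally finite (each vertex belongs to finitely many edges, and each ball of finite radius contains finitely many vertices). Let a group $\Gamma$ act on $J$ by isometries. Fix $0<\lambda<1$ and a vertex $\xi$. *The absolute and hierarchomorphisms.* The absolute $\mathrm{Abs}(J)$ is the set of rays (infinite sequences $a_1,a_2,\dots$ of distinct, consecutively adjacent vertices), where rays that eventually coincide up to a shift of the numbering are identified. A subtree is *right* if only finitely many edges leave it, and a *branch* if exactly one edge leaves it; the *ball* $B[S]$ of a branch $S$ is the set of points of $\mathrm{Abs}(J)$ represented by rays in $S$. The balls generate the topology of $\mathrm{Abs}(J)$. $\mathrm{Hier}^\circ(J,\Gamma)$ consists of the bijections $g$ of $\mathrm{Vert}(J)$ for which there is a finite partition of $J$ into right subtrees $S_1,\dots,S_k$ such that on each $S_j$ the map $g$ coincides with an element of $\Gamma$. Such a $g$ maps tails of rays to rays and so induces a bijection $\omega\mapsto g\omega$ of $\mathrm{Abs}(J)$;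 $\mathrm{Hier}(J,\Gamma)$ is the set of the bijections of $\mathrm{Abs}(J)$ obtained in this way. The pseudoderivative $n(g,\omega)$ is the eventual value of $\rho(\xi,a_M)-\rho(\xi,ga_M)$ along a ray $a_1,a_2,\dots$ that leads to $\omega$. *The space $\mathcal E_\lambda(J)$.* Let $\mathcal H_\lambda(J)$ be the real Hilbert space spanned by vectors $e_a$, $a\in\mathrm{Vert}(J)$, with $\langle e_a,e_b\rangle=\lambda^{\rho(a,b)}$, and put $f_a=\lambda^{-\rho(\xi,a)}e_a$. A finite subtree $R$ is *complete* if each vertex of $R$ has either all of its neighbours or exactly one of them in $R$, and $\xi$ has all of its neighbours in $R$; $\partial R$ is the set of vertices of $R$ that have a neighbour outside $R$. For a real signed Borel measure $\mu$ of finite variation on $\mathrm{Abs}(J)$ put $$\Psi[\mu|R]=\sum_{u\in\partial R}\mu(B[S_u])\,f_u,$$ where $S_u$ is the branch with root $u$ that does not contain $\xi$. The space $\mathcal E_\lambda(J)$ consists of the $\mu$ for which the norms $\|\Psi[\mu|R]\|$ (which increase with $R$) have a finite limit along the complete subtrees $R$; for such $\mu$ let $\Psi[\mu]=\lim_R\Psi[\mu|R]$,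 and equip $\mathcal E_\lambda(J)$ with the inner product $\langle\mu,\nu\rangle=\langle\Psi[\mu],\Psi[\nu]\rangle_{\mathcal H_\lambda(J)}$. **Theorem.** For every element of $\mathrm{Hier}(J,\Gamma)$, induced by $g\in\mathrm{Hier}^\circ(J,\Gamma)$, the formula $$T_\lambda(g)\mu(\omega)=\lambda^{n(g,\omega)}\cdot\mu(g\omega),$$ in which $\mu(g\omega)$ denotes the measure $A\mapsto\mu(gA)$ (so that $T_\lambda(g)\mu$ is the measure with density $\lambda^{n(g,\cdot)}$ with respect to it), defines an operator $T_\lambda(g)$ in $\mathcal E_\lambda(J)$ of the form $T_\lambda(g)=A(1+Q)$, where $A$ is an orthogonal operator (an invertible linear operator in $\mathcal E_\lambda(J)$ preserving the inner product) and $Q$ is a bounded linear operator of finite rank in $\mathcal E_\lambda(J)$. -/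

import Mathlib

open Filter Topology MeasureTheory

/-- A metric tree with vertex set `V`: a connected graph without circuits, each edge of which has
a positive length (the values of `len` off the edge set are irrelevant). -/
structure MetricTree (V : Type*) where
  graph : SimpleGraph V
  isTree : graph.IsTree
  len : Sym2 V → ℝ
  len_pos : ∀ e ∈ graph.edgeSet, 0 < len e

namespace MetricTree

noncomputable section

variable {V : Type*} (J : MetricTree V)

/-- The unique path connecting two vertices. -/
def path (a b : V) : J.graph.Walk a b := (J.isTree.existsUnique_path a b).choose

/-- The distance between two vertices: the total length of the path connecting them. -/
def rho (a b : V) : ℝ := ((J.path a b).edges.map J.len).sum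

/-- Every vertex belongs to at least three edges. -/
def IsPerfect : Prop := ∀ a, 3 ≤ (J.graph.neighborSet a).encard

/-- Every vertex belongs to finitely many edges, and every ball of finite radius in the set of
vertices is finite. -/
def IsLocallyFinite : Prop :=
  (∀ a, (J.graph.neighborSet a).Finite) ∧ ∀ (a : V) (C : ℝ), {b | J.rho a b < C}.Finite

/-! ### Subtrees -/

/-- `S` is the vertex set of a subtree. -/
def IsSubtree (S : Set V) : Prop := (J.graph.induce S).Connected

/-- The edges `[a,b]` with `a ∈ S`, `b ∉ S`. -/
def cutEdges (S : Set V) : Set (V × V) := {p | J.graph.Adj p.1 p.2 ∧ p.1 ∈ S ∧ p.2 ∉ S}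

/-- Right subtrees: only finitely many edges leave the subtree. -/
def IsRight (S : Set V) : Prop := J.IsSubtree S ∧ (J.cutEdges S).Finite

/-- Branches: exactly one edge leaves the subtree. -/
def IsBranch (S : Set V) : Prop := J.IsSubtree S ∧ ∃! p, p ∈ J.cutEdges S

/-- The branch with root `u` that does not contain `ξ` (for `u ≠ ξ`): the vertices `v` such that
the path from `ξ` to `v` passes through `u`. -/
def outerBranch (ξ u : V) : Set V := {v | u ∈ (J.path ξ v).support}

/-! ### The absolute -/

/-- A ray: a sequence of distinct vertices, consecutive ones being adjacent. -/
def Ray : Type _ :=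
  {a : ℕ → V // Function.Injective a ∧ ∀ i, J.graph.Adj (a i) (a (i + 1))}

/-- Two rays are equivalent if they coincide eventually, up to a shift of the numbering. -/
instance raySetoid : Setoid J.Ray where
  r a b := ∃ m n, ∀ i, a.1 (m + i) = b.1 (n + i)
  iseqv :=
    { refl := fun _ => ⟨0, 0, fun _ => rfl⟩
      symm := fun ⟨m, n, h⟩ => ⟨n, m, fun i => (h i).symm⟩
      trans := by
        rintro a b c ⟨m, n, h⟩ ⟨m', n', h'⟩
        refine ⟨m + m', n' + n, fun i => ?_⟩
        have h1 := h (m' + i)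
        have h2 := h' (n + i)
        rw [show m + m' + i = m + (m' + i) by omega, h1,
          show n + (m' + i) = m' + (n + i) by omega, h2,
          show n' + n + i = n' + (n + i) by omega] }

/-- The absolute of the tree: the set of classes of equivalent rays. -/
def Abs : Type _ := Quotient J.raySetoid

/-- The point of the absolute to which a ray leads. -/
def Ray.toAbs {J : MetricTree V} (a : J.Ray) : J.Abs := Quotient.mk _ a

/-- The absolute of a subtree `S`, as a subset of `Abs(J)`. If `S` is a branch, this is the
ball `B[S]`. -/
def ends (S : Set V) : Set J.Abs := {ω | ∃ a : J.Ray, a.toAbs = ω ∧ ∀ i, a.1 i ∈ S}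

/-- The topology of the absolute, generated by the balls. (The complement of a ball is a ball.) -/
instance : TopologicalSpace J.Abs :=
  TopologicalSpace.generateFrom {B | ∃ S, J.IsBranch S ∧ B = J.ends S}

/-- The Borel sets of the absolute. -/
instance : MeasurableSpace J.Abs := borel J.Abs

/-! ### Hierarchomorphisms -/

/-- The group `Γ` acts on the metric tree by isometries. -/
def ActsByIsometries (Γ : Type*) [Group Γ] [MulAction Γ V] : Prop :=
  ∀ (γ : Γ) (a b : V), J.rho (γ • a) (γ • b) = J.rho a b

/-- `Hier°(J,Γ)`: the bijections `g` of the set of vertices for which there is a finite partition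
of the tree into right subtrees `S j` such that `g` acts on each `S j` as an element of `Γ`. -/
def HierCirc (Γ : Type*) [Group Γ] [MulAction Γ V] : Set (Equiv.Perm V) :=
  {g | ∃ (k : ℕ) (S : Fin k → Set V) (γ : Fin k → Γ),
    (∀ j, J.IsRight (S j)) ∧ (Pairwise fun i j => Disjoint (S i) (S j)) ∧
    (⋃ j, S j) = Set.univ ∧ ∀ j, ∀ a ∈ S j, g a = γ j • a}

/-- `φ` is the transformation of the absolute induced by the bijection `g` of the set of vertices:
for each ray `a`, the images under `g` of the vertices of a tail of `a` form a ray,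
and it leads to the `φ`-image of the point to which `a` leads. -/
def Induces (g : Equiv.Perm V) (φ : Equiv.Perm J.Abs) : Prop :=
  ∀ a : J.Ray, ∃ (N : ℕ) (b : J.Ray), (∀ i, b.1 i = g (a.1 (N + i))) ∧ φ a.toAbs = b.toAbs

/-- `Hier(J,Γ)`: the transformations of the absolute induced by the elements of `Hier°(J,Γ)`. -/
def Hier (Γ : Type*) [Group Γ] [MulAction Γ V] : Set (Equiv.Perm J.Abs) :=
  {φ | ∃ g ∈ J.HierCirc Γ, J.Induces g φ}

/-- The pseudoderivative `n_ξ(g,ω)`: the eventual value of `ρ(ξ,a_M) - ρ(ξ,g a_M)` along any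
ray `a` that leads to `ω`. -/
def pseudoderivative (ξ : V) (g : Equiv.Perm V) (ω : J.Abs) : ℝ :=
  Quotient.lift
    (fun a : J.Ray => limUnder atTop fun M => J.rho ξ (a.1 M) - J.rho ξ (g (a.1 M)))
    (by
      rintro a b ⟨m, n, h⟩
      have key : ∀ (c : J.Ray) (k : ℕ),
          map (fun M => J.rho ξ (c.1 M) - J.rho ξ (g (c.1 M))) atTop =
          map (fun i => J.rho ξ (c.1 (k + i)) - J.rho ξ (g (c.1 (k + i)))) atTop := by
        intro c k
        conv_lhs => rw [← map_add_atTop_eq_nat k, Filter.map_map]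
        congr 1
        funext i
        simp [add_comm]
      simp only [limUnder]
      rw [key a m, key b n]
      simp only [h]) ω

/-! ### The Hilbert space `H_λ(J)`

The Hilbert space spanned by vectors `e_a`, `a ∈ Vert(J)`, with `⟨e_a, e_b⟩ = λ ^ ρ(a,b)`, is
unique up to a canonical isometry. It is realized here in `ℓ²(Vert(J))`; the formula for the inner
products is proved below (`inner_basisVec`). -/

/-- `1` at the base vertex, and `√(1 - λ ^ (2 ℓ))` at a vertex `v ≠ ξ`, where `ℓ` is the length of
the last edge of the path from `ξ` to `v`. -/
def stepCoeff (ξ : V) (lam : ℝ) (v : V) : ℝ :=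
  open Classical in
  if v = ξ then 1 else √(1 - lam ^ (2 * J.len s((J.path ξ v).penultimate, v)))

/-- The realization of the vector `e_a` in `ℓ²(Vert(J))`. -/
def ambientVec (ξ : V) (lam : ℝ) (a : V) : lp (fun _ : V => ℝ) 2 :=
  open Classical in
  ∑ v ∈ (J.path ξ a).support.toFinset,
    lp.single 2 v (J.stepCoeff ξ lam v * lam ^ J.rho v a)

/-- The Hilbert space `H_λ(J)`: the closed linear span of the vectors `e_a`. -/
def HSpace (ξ : V) (lam : ℝ) : Submodule ℝ (lp (fun _ : V => ℝ) 2) :=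
  (Submodule.span ℝ (Set.range (J.ambientVec ξ lam))).topologicalClosure

/-- The vector `e_a` of `H_λ(J)`. -/
def basisVec (ξ : V) (lam : ℝ) (a : V) : J.HSpace ξ lam :=
  ⟨J.ambientVec ξ lam a,
    Submodule.le_topologicalClosure _ (Submodule.subset_span (Set.mem_range_self a))⟩

/-- The vector `f_a = λ ^ (-ρ(ξ,a)) e_a`. -/
def normVec (ξ : V) (lam : ℝ) (a : V) : J.HSpace ξ lam :=
  lam ^ (-J.rho ξ a) • J.basisVec ξ lam a

section Gram

lemma path_isPath (a b : V) : (J.path a b).IsPath :=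
  (J.isTree.existsUnique_path a b).choose_spec.1

lemma path_unique {a b : V} (p : J.graph.Walk a b) (hp : p.IsPath) : J.path a b = p :=
  ((J.isTree.existsUnique_path a b).choose_spec.2 p hp).symm

lemma path_self (a : V) : J.path a a = .nil := J.path_unique _ .nil

lemma rho_self (a : V) : J.rho a a = 0 := by simp [rho, J.path_self]

lemma rho_comm (a b : V) : J.rho a b = J.rho b a := by
  rw [rho, J.path_unique _ (J.path_isPath b a).reverse]
  simp [rho]

lemma path_support_subset {a b : V} (p : J.graph.Walk a b) :
    (J.path a b).support ⊆ p.support := by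
  classical
  rw [J.path_unique _ p.bypass_isPath]
  exact p.support_bypass_subset_support

lemma rho_step {v p a : V} (hadj : J.graph.Adj p a) (h : a ∉ (J.path v p).support) :
    J.rho v a = J.rho v p + J.len s(p, a) := by
  rw [rho, J.path_unique _ ((J.path_isPath v p).concat h hadj)]
  simp [rho, SimpleGraph.Walk.edges_concat]

lemma path_last {ξ a : V} (h : a ≠ ξ) : ∃ p, ∃ hadj : J.graph.Adj p a,
    p = (J.path ξ a).penultimate ∧ J.path ξ a = (J.path ξ p).concat hadj ∧
      a ∉ (J.path ξ p).support := by
  have hnil : ¬ (J.path ξ a).Nil := fun hn => h hn.eq.symm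
  refine ⟨_, SimpleGraph.Walk.adj_penultimate hnil, rfl, ?_⟩
  have h1 : J.path ξ (J.path ξ a).penultimate = (J.path ξ a).dropLast :=
    J.path_unique _ (J.path_isPath ξ a).dropLast
  have h2 := SimpleGraph.Walk.concat_dropLast (SimpleGraph.Walk.adj_penultimate hnil)
  refine ⟨by rw [h1, h2], ?_⟩
  have h3 := J.path_isPath ξ a
  rw [← h2, SimpleGraph.Walk.concat_isPath_iff] at h3
  rw [h1]
  exact h3.2

open Classical in
/-- The inner product of the realizations of `e_a` and `e_b`, written out in coordinates. -/
def gramSum (ξ : V) (lam : ℝ) (a b : V) : ℝ :=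
  ∑ v ∈ (J.path ξ a).support.toFinset ∩ (J.path ξ b).support.toFinset,
    J.stepCoeff ξ lam v ^ 2 * (lam ^ J.rho v a * lam ^ J.rho v b)

lemma gramSum_comm (ξ : V) (lam : ℝ) (a b : V) : J.gramSum ξ lam a b = J.gramSum ξ lam b a := by
  classical
  simp only [gramSum]
  rw [Finset.inter_comm]
  exact Finset.sum_congr rfl fun v _ => by ring

lemma rho_step_of_mem {ξ p a v : V} (hadj : J.graph.Adj p a) (h : a ∉ (J.path ξ p).support)
    (hv : v ∈ (J.path ξ p).support) : J.rho v a = J.rho v p + J.len s(p, a) := by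
  classical
  refine J.rho_step hadj fun hm => h ?_
  exact (J.path ξ p).support_dropUntil_subset_support hv
    (J.path_support_subset ((J.path ξ p).dropUntil v hv) hm)

lemma gramSum_eq {lam : ℝ} (h0 : 0 < lam) (h1 : lam < 1) (ξ : V) : ∀ (n : ℕ) (a b : V),
    (J.path ξ a).length + (J.path ξ b).length = n → J.gramSum ξ lam a b = lam ^ J.rho a b := by
  classical
  intro n
  induction n using Nat.strong_induction_on with
  | _ n ih =>
  have main : ∀ a b : V, (J.path ξ a).length + (J.path ξ b).length = n →
      (J.path ξ b).length ≤ (J.path ξ a).length → J.gramSum ξ lam a b = lam ^ J.rho a b := by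
    intro a b hn hle
    by_cases haξ : a = ξ
    · subst haξ
      have hb : b = a := by
        have : (J.path a b).length = 0 := by
          rw [J.path_self] at hle; simpa using hle
        exact (SimpleGraph.Walk.eq_of_length_eq_zero this).symm
      subst hb
      simp [gramSum, J.path_self, J.rho_self, stepCoeff]
    obtain ⟨p, hadj, hp, hpath, hnot⟩ := J.path_last haξ
    have hsupp : (J.path ξ a).support.toFinset
        = insert a (J.path ξ p).support.toFinset := by
      rw [hpath, SimpleGraph.Walk.support_concat]
      ext v
      simp
    have hlen : (J.path ξ a).length = (J.path ξ p).length + 1 := by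
      rw [hpath, SimpleGraph.Walk.length_concat]
    by_cases hab : a = b
    · subst hab
      have e1 : J.gramSum ξ lam a a = J.stepCoeff ξ lam a ^ 2 +
          lam ^ (2 * J.len s(p, a)) * J.gramSum ξ lam p p := by
        simp only [gramSum, Finset.inter_self]
        rw [hsupp, Finset.sum_insert (by simpa using hnot), J.rho_self, Finset.mul_sum]
        congr 1
        · simp
        · refine Finset.sum_congr rfl fun v hv => ?_
          rw [J.rho_step_of_mem hadj hnot (by simpa using hv), two_mul, Real.rpow_add h0,
            Real.rpow_add h0]
          ring
      rw [e1, ih _ (by omega) p p rfl, J.rho_self, J.rho_self, stepCoeff, if_neg haξ, ← hp,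
        Real.sq_sqrt]
      · simp
      · have hl : 0 ≤ 2 * J.len s(p, a) := by
          have := J.len_pos s(p, a) hadj
          positivity
        linarith [Real.rpow_le_one h0.le h1.le hl]
    · have hanb : a ∉ (J.path ξ b).support := by
        intro hm
        have hlt := SimpleGraph.Walk.length_takeUntil_lt_length hm hab
        rw [← J.path_unique _ ((J.path_isPath ξ b).takeUntil hm)] at hlt
        omega
      have e1 : J.gramSum ξ lam a b = lam ^ J.len s(p, a) * J.gramSum ξ lam p b := by
        simp only [gramSum]
        rw [hsupp, Finset.insert_inter_of_notMem (by simpa using hanb), Finset.mul_sum]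
        refine Finset.sum_congr rfl fun v hv => ?_
        rw [J.rho_step_of_mem hadj hnot (by simpa using (Finset.mem_inter.1 hv).1),
          Real.rpow_add h0]
        ring
      have e2 : J.rho b a = J.rho b p + J.len s(p, a) := by
        refine J.rho_step hadj fun hm => ?_
        have := J.path_support_subset ((J.path ξ b).reverse.append (J.path ξ p)) hm
        rw [SimpleGraph.Walk.mem_support_append_iff] at this
        rcases this with h | h
        · exact hanb (by simpa using h)
        · exact hnot h
      rw [e1, ih _ (by omega) p b rfl, J.rho_comm a b, e2, J.rho_comm p b, Real.rpow_add h0]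
      ring
  intro a b hn
  rcases le_total (J.path ξ b).length (J.path ξ a).length with h | h
  · exact main a b hn h
  · rw [J.gramSum_comm, J.rho_comm]
    exact main b a (by omega) h

/-- The defining property of `H_λ(J)`: `⟨e_a, e_b⟩ = λ ^ ρ(a,b)`. -/
theorem inner_basisVec {lam : ℝ} (h0 : 0 < lam) (h1 : lam < 1) (ξ a b : V) :
    inner ℝ (J.basisVec ξ lam a) (J.basisVec ξ lam b) = lam ^ J.rho a b := by
  classical
  rw [← J.gramSum_eq h0 h1 ξ _ a b rfl, Submodule.coe_inner]
  simp only [basisVec, ambientVec, sum_inner, inner_sum, lp.inner_single_left]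
  simp only [gramSum, lp.coeFn_single, Pi.single_apply]
  rw [Finset.sum_comm]
  rw [← Finset.sum_filter_add_sum_filter_not (J.path ξ a).support.toFinset
    (fun v => v ∈ (J.path ξ b).support.toFinset)]
  rw [Finset.sum_eq_zero (s := Finset.filter (fun v => ¬ _) _), add_zero,
    Finset.filter_mem_eq_inter]
  · refine Finset.sum_congr rfl fun v hv => ?_
    rw [Finset.sum_eq_single v]
    · simp; ring
    · intro w _ hw
      simp [hw.symm]
    · intro h
      exact absurd (Finset.mem_inter.1 hv).2 h
  · intro v hv
    refine Finset.sum_eq_zero fun w hw => ?_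
    have : v ≠ w := by
      rintro rfl
      exact (Finset.mem_filter.1 hv).2 hw
    simp [this]

end Gram

/-! ### The boundary space `E_λ(J)` -/

/-- The finite complete subtrees `R` with `ξ` in `R` but not in the boundary of `R`: for each
vertex of `R`, either all its neighbours or exactly one of its neighbours lie in `R`. -/
def IsCompleteSubtree (ξ : V) (R : Finset V) : Prop :=
  J.IsSubtree (R : Set V) ∧
  (∀ a ∈ R, (∀ b, J.graph.Adj a b → b ∈ R) ∨ ∃! b, J.graph.Adj a b ∧ b ∈ R) ∧
  ξ ∈ R ∧ ∀ b, J.graph.Adj ξ b → b ∈ R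

/-- The type of finite complete subtrees, ordered by inclusion. -/
abbrev CompleteSubtree (ξ : V) : Type _ := {R : Finset V // J.IsCompleteSubtree ξ R}

/-- The boundary of a subtree: its vertices that are adjacent to a vertex outside. -/
def boundary (R : Finset V) : Finset V :=
  open Classical in R.filter fun a => ∃ b, J.graph.Adj a b ∧ b ∉ R

/-- The vector `Ψ[μ|R] = ∑ μ(B[S_u]) f_u`, where the sum is over the boundary of `R`. -/
def psiOn (ξ : V) (lam : ℝ) (R : J.CompleteSubtree ξ) (μ : SignedMeasure J.Abs) :
    J.HSpace ξ lam :=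
  ∑ u ∈ J.boundary R.1, μ (J.ends (J.outerBranch ξ u)) • J.normVec ξ lam u

/-- The linear space of the real charges of finite variation `μ` on the absolute for which
`lim_R ‖Ψ[μ|R]‖` is finite. (The norms increase with `R`, so the limit is the supremum.) -/
def chargeSpace (ξ : V) (lam : ℝ) : Submodule ℝ (SignedMeasure J.Abs) where
  carrier := {μ | ∃ C : ℝ, ∀ R : J.CompleteSubtree ξ, ‖J.psiOn ξ lam R μ‖ ≤ C}
  zero_mem' := ⟨0, fun R => by simp [psiOn]⟩
  add_mem' := by
    rintro μ ν ⟨C, hC⟩ ⟨D, hD⟩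
    refine ⟨C + D, fun R => ?_⟩
    have : J.psiOn ξ lam R (μ + ν) = J.psiOn ξ lam R μ + J.psiOn ξ lam R ν := by
      simp [psiOn, add_smul, Finset.sum_add_distrib]
    rw [this]
    exact (norm_add_le _ _).trans (add_le_add (hC R) (hD R))
  smul_mem' := by
    rintro c μ ⟨C, hC⟩
    refine ⟨‖c‖ * C, fun R => ?_⟩
    have : J.psiOn ξ lam R (c • μ) = c • J.psiOn ξ lam R μ := by
      simp [psiOn, mul_smul, Finset.smul_sum]
    rw [this, norm_smul]
    exact mul_le_mul_of_nonneg_left (hC R) (norm_nonneg c)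

/-- The space `E_λ(J)`. -/
def ESpace (ξ : V) (lam : ℝ) : Type _ := ↥(J.chargeSpace ξ lam)

instance (ξ : V) (lam : ℝ) : AddCommGroup (J.ESpace ξ lam) :=
  inferInstanceAs (AddCommGroup ↥(J.chargeSpace ξ lam))

instance (ξ : V) (lam : ℝ) : Module ℝ (J.ESpace ξ lam) :=
  inferInstanceAs (Module ℝ ↥(J.chargeSpace ξ lam))

/-- An element of `E_λ(J)`, viewed as a charge on the absolute. -/
def toCharge {ξ : V} {lam : ℝ} : J.ESpace ξ lam →ₗ[ℝ] SignedMeasure J.Abs :=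
  (J.chargeSpace ξ lam).subtype

/-- The vector `Ψ[μ] = lim_R Ψ[μ|R]`, the limit being taken over the finite complete subtrees
directed by inclusion. -/
def psi (ξ : V) (lam : ℝ) (μ : J.ESpace ξ lam) : J.HSpace ξ lam :=
  limUnder atTop fun R : J.CompleteSubtree ξ => J.psiOn ξ lam R (J.toCharge μ)

/-- The inner product `⟨μ, ν⟩ = ⟨Ψ[μ], Ψ[ν]⟩` of `E_λ(J)`. -/
def innerE (ξ : V) (lam : ℝ) (μ ν : J.ESpace ξ lam) : ℝ :=
  inner ℝ (J.psi ξ lam μ) (J.psi ξ lam ν)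

/-- The norm of `E_λ(J)`. -/
def normE (ξ : V) (lam : ℝ) (μ : J.ESpace ξ lam) : ℝ := ‖J.psi ξ lam μ‖

/-- Orthogonal operators in `E_λ(J)`: invertible linear operators preserving the inner product. -/
def IsOrthogonalOp {ξ : V} {lam : ℝ} (A : J.ESpace ξ lam ≃ₗ[ℝ] J.ESpace ξ lam) : Prop :=
  ∀ μ ν, J.innerE ξ lam (A μ) (A ν) = J.innerE ξ lam μ ν

/-- Bounded linear operators of finite rank in `E_λ(J)`. -/
def IsFiniteRankOp {ξ : V} {lam : ℝ} (Q : J.ESpace ξ lam →ₗ[ℝ] J.ESpace ξ lam) : Prop :=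
  FiniteDimensional ℝ (LinearMap.range Q) ∧
  ∃ C : ℝ, ∀ μ, J.normE ξ lam (Q μ) ≤ C * J.normE ξ lam μ

/-- The operator `T_λ`, `T_λ μ(ω) = λ ^ n(g,ω) · μ(gω)`, where `φ` is the transformation
`ω ↦ gω` of the absolute that is induced by `g`. Here `μ(gω)` is the charge `A ↦ μ(gA)`, that is,
the image of `μ` under the inverse of `φ`. -/
def boundaryOp (ξ : V) (lam : ℝ) (g : Equiv.Perm V) (φ : Equiv.Perm J.Abs)
    (μ : SignedMeasure J.Abs) : SignedMeasure J.Abs :=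
  (μ.map φ.symm).withDensity (fun ω => lam ^ J.pseudoderivative ξ g ω)
    (ContinuousLinearMap.lsmul ℝ ℝ)

end

end MetricTree

/-!
# Hierarchomorphisms act on `E_λ(J)` by orthogonal operators up to finite rank

In `ℓ²(Vert(J))` the vector `f_a` has the coordinate `coef v` at the vertices `v` of the path from
`ξ` to `a`, and `0` elsewhere. Hence `Ψ[μ]` has the coordinates `coef v * μ(B_v)`, where `B_v` is
the ball of the branch with root `v` away from `ξ` (`MetricTree.coe_psi`). So `E_λ(J)` consists of
the charges for which these coordinates are square summable. A charge is determined by the *flow*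
`v ↦ μ(B_v)`, whose value at each vertex is the sum of its values at the children
(`MetricTree.charge_ext`), but not every flow comes from a charge of finite variation.

A hierarchomorphism `g` is, at large depth, an isometry of branches onto branches
(`MetricTree.exists_rigidBeyond`). There the density `λ ^ n(g,ω)` compensates exactly for the
change of the weights, so `T_λ(g)` permutes all but finitely many coordinates of `Ψ[μ]`
(`MetricTree.embed_boundaryMap`). Consequently `T = T_λ(g)` is a bijection of `E_λ(J)`, and
`⟨Tμ,Tν⟩ = ⟨μ,ν⟩` for all `ν` if `μ` vanishes on the balls of depth at most `m`, with `m` large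
(`MetricTree.inner_embed_boundaryMap`).

Let `F` be the orthogonal complement of these `μ`. If `E_λ(J) = F ⊕ Fᗮ` with `F` of finite
dimension, then `T` maps the summands to orthogonal subspaces. Replacing `T` on `F` by an isometry
onto `T F` gives the orthogonal operator `A`, and `A⁻¹T - 1` vanishes on `Fᗮ`
(`exists_orthogonal_factor`).

Since `E_λ(J)` need not be complete, the point is that the complement `F`, formed in the Hilbert
space of all square summable flows, consists of charges of finite variation
(`MetricTree.equilibriumSpace_le_range`). On each branch of large depth, a flow in `F` has minimal
norm among the flows with the same value at the root of the branch, and therefore does not take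
opposite signs at siblings (`MetricTree.mul_nonneg_of_mem_equilibriumSpace`): it splits into two
nonnegative flows at large depth. A nonnegative flow comes from a measure, the image of Lebesgue
measure on an interval that is subdivided repeatedly according to the flow
(`MetricTree.exists_charge_of_nonneg_flow`).
-/

/-! ### Orthogonal factors of operators that are isometric up to finite rank -/

/-- An invertible operator `T` that preserves the inner products with the vectors of `Fᗮ`, where
`F` has finite dimension, maps `Fᗮ` and `F` to orthogonal subspaces. Replacing its restriction to
`F` by an isometry with the same image gives the orthogonal factor. -/
lemma exists_linearIsometryEquiv_factor {E : Type*} [NormedAddCommGroup E] [InnerProductSpace ℝ E]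
    (F : Submodule ℝ E) [FiniteDimensional ℝ F] (T : E ≃ₗ[ℝ] E)
    (hT : ∀ x ∈ Fᗮ, ∀ y, inner ℝ (T x) (T y) = inner ℝ x y) :
    ∃ (A : E ≃ₗᵢ[ℝ] E) (Q : E →L[ℝ] E), FiniteDimensional ℝ (LinearMap.range Q.toLinearMap) ∧
      ∀ x, T x = A (x + Q x) := by
  let F' := F.map T.toLinearMap
  let S : F ≃ₗ[ℝ] F' := T.submoduleMap F
  have hrank : Module.finrank ℝ F = Module.finrank ℝ F' := S.finrank_eq
  let i : F ≃ₗᵢ[ℝ] F' :=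
    (stdOrthonormalBasis ℝ F).equiv (stdOrthonormalBasis ℝ F') (finCongr hrank)
  let P := F.orthogonalProjectionOnto
  have hP : ∀ x, x - P x ∈ Fᗮ := fun x => F.sub_starProjection_mem_orthogonal x
  have hPF : ∀ f : F, P (f : E) = f := fun f => F.orthogonalProjectionOnto_mem_subspace_eq_self f
  -- images of `Fᗮ` and of `F` are orthogonal
  have horth : ∀ x, ∀ f' : F', inner ℝ (T (x - P x)) (f' : E) = 0 := by
    rintro x ⟨_, f, hf, rfl⟩
    exact (hT _ (hP x) f).trans (Submodule.inner_left_of_mem_orthogonal hf (hP x))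
  let A₀ : E →ₗ[ℝ] E := T.toLinearMap ∘ₗ (LinearMap.id - F.subtype ∘ₗ P.toLinearMap) +
    F'.subtype ∘ₗ i.toLinearEquiv.toLinearMap ∘ₗ P.toLinearMap
  have hA₀ : ∀ x, A₀ x = T (x - P x) + i (P x) := fun x => rfl
  have hnorm : ∀ x, ‖A₀ x‖ = ‖x‖ := by
    intro x
    have h1 : ‖A₀ x‖ * ‖A₀ x‖ = ‖x‖ * ‖x‖ := by
      rw [hA₀, norm_add_sq_eq_norm_sq_add_norm_sq_real (horth x (i (P x)))]
      have h2 : ‖T (x - P x)‖ * ‖T (x - P x)‖ = ‖x - P x‖ * ‖x - P x‖ := by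
        rw [← real_inner_self_eq_norm_mul_norm, ← real_inner_self_eq_norm_mul_norm,
          hT _ (hP x)]
      rw [h2, ← Submodule.coe_norm, LinearIsometryEquiv.norm_map, Submodule.coe_norm,
        ← norm_add_sq_eq_norm_sq_add_norm_sq_real
          (Submodule.inner_left_of_mem_orthogonal (P x).2 (hP x)), sub_add_cancel]
    exact (mul_self_inj (norm_nonneg _) (norm_nonneg _)).1 h1
  have hsurj : Function.Surjective A₀ := by
    intro y
    obtain ⟨x, rfl⟩ := T.surjective y
    let f : F := i.symm (S (P x))
    refine ⟨x - P x + f, ?_⟩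
    have hPx : P (x - P x + f) = f := by
      rw [map_add, map_sub, hPF, hPF, sub_self, zero_add]
    rw [hA₀, hPx, add_sub_cancel_right, i.apply_symm_apply]
    change T (x - P x) + T (P x) = T x
    rw [← map_add, sub_add_cancel]
  let q : F →ₗ[ℝ] F := i.symm.toLinearEquiv.toLinearMap ∘ₗ S.toLinearMap - LinearMap.id
  let Q : E →L[ℝ] E := F.subtypeL ∘L LinearMap.toContinuousLinearMap q ∘L P
  have hQ : ∀ x, Q x = (q (P x) : F) := fun x => rfl
  refine ⟨LinearIsometryEquiv.ofSurjective ⟨A₀, hnorm⟩ hsurj, Q, ?_, fun x => ?_⟩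
  · refine Submodule.finiteDimensional_of_le (S₂ := F) ?_
    rintro _ ⟨x, rfl⟩
    exact (q (P x)).2
  · change T x = A₀ (x + Q x)
    have hPx : P (x + Q x) = i.symm (S (P x)) := by
      rw [map_add, hQ, hPF]
      simp [q]
    have h3 : x + Q x - P (x + Q x) = x - P x := by
      rw [hPx, hQ]
      simp only [q, LinearMap.sub_apply, LinearMap.comp_apply, LinearMap.id_apply,
        Submodule.coe_sub]
      change x + ((i.symm (S (P x)) : E) - P x) - i.symm (S (P x)) = _
      abel
    rw [hA₀, h3, hPx, i.apply_symm_apply]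
    change T x = T (x - P x) + T (P x)
    rw [← map_add, sub_add_cancel]

/-- The same for the inner product that is induced from `H` by an injective linear map. -/
lemma exists_orthogonal_factor {E H : Type*} [AddCommGroup E] [Module ℝ E]
    [NormedAddCommGroup H] [InnerProductSpace ℝ H] (Φ : E →ₗ[ℝ] H) (hΦ : Function.Injective Φ)
    (F : Submodule ℝ H) [FiniteDimensional ℝ F] (hF : F ≤ LinearMap.range Φ) (T : E ≃ₗ[ℝ] E)
    (hT : ∀ μ, Φ μ ∈ Fᗮ → ∀ ν, inner ℝ (Φ (T μ)) (Φ (T ν)) = inner ℝ (Φ μ) (Φ ν)) :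
    ∃ (A : E ≃ₗ[ℝ] E) (Q : E →ₗ[ℝ] E),
      (∀ μ ν, inner ℝ (Φ (A μ)) (Φ (A ν)) = inner ℝ (Φ μ) (Φ ν)) ∧
      FiniteDimensional ℝ (LinearMap.range Q) ∧ (∃ C : ℝ, ∀ μ, ‖Φ (Q μ)‖ ≤ C * ‖Φ μ‖) ∧
      ∀ μ, T μ = A (μ + Q μ) := by
  let e : E ≃ₗ[ℝ] LinearMap.range Φ := LinearEquiv.ofInjective Φ hΦ
  have he : ∀ μ, (e μ : H) = Φ μ := fun μ => rfl
  have hes : ∀ x, Φ (e.symm x) = x := fun x => by rw [← he, e.apply_symm_apply]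
  let F₁ : Submodule ℝ (LinearMap.range Φ) := F.comap (LinearMap.range Φ).subtype
  have hfin : FiniteDimensional ℝ F₁ := (Submodule.comapSubtypeEquivOfLe hF).symm.finiteDimensional
  obtain ⟨A, Q, hQ, hfac⟩ := exists_linearIsometryEquiv_factor F₁ (e.symm ≪≫ₗ T ≪≫ₗ e) (by
    intro x hx y
    rw [Submodule.coe_inner, Submodule.coe_inner]
    have h1 : Φ (e.symm x) ∈ Fᗮ := by
      rw [hes, Submodule.mem_orthogonal]
      intro f hf
      exact (Submodule.mem_orthogonal _ _).1 hx ⟨f, hF hf⟩ hf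
    have h2 := hT _ h1 (e.symm y)
    rwa [hes, hes] at h2)
  refine ⟨e ≪≫ₗ A.toLinearEquiv ≪≫ₗ e.symm, e.symm.toLinearMap ∘ₗ Q.toLinearMap ∘ₗ e.toLinearMap,
    fun μ ν => ?_, ?_, ⟨‖Q‖, fun μ => ?_⟩, fun μ => ?_⟩
  · change inner ℝ (Φ (e.symm (A (e μ)))) (Φ (e.symm (A (e ν)))) = _
    rw [hes, hes, ← Submodule.coe_inner, A.inner_map_map]
    rfl
  · rw [LinearMap.range_comp, LinearMap.range_comp_of_range_eq_top _ e.range]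
    infer_instance
  · change ‖Φ (e.symm (Q (e μ)))‖ ≤ _
    rw [hes]
    exact Q.le_opNorm (e μ)
  · have := congrArg e.symm (hfac (e μ))
    simp only [LinearEquiv.trans_apply, LinearEquiv.symm_apply_apply] at this
    rw [this]
    change _ = e.symm (A (e (μ + e.symm (Q (e μ)))))
    rw [map_add e, e.apply_symm_apply]

namespace MetricTree

noncomputable section

section Tree

variable {V : Type*} (J : MetricTree V)

/-! ### The rooted tree -/

/-- The number of edges of the path from `ξ` to `v`. -/
def depth (ξ v : V) : ℕ := (J.path ξ v).length

/-- The last vertex before `v` on the path from `ξ` to `v`; the value at `v = ξ` is `ξ`. -/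
def parent (ξ v : V) : V := (J.path ξ v).penultimate

lemma depth_self (ξ : V) : J.depth ξ ξ = 0 := by simp [depth, J.path_self]

lemma depth_eq_zero {ξ v : V} : J.depth ξ v = 0 ↔ v = ξ :=
  ⟨fun h => (SimpleGraph.Walk.eq_of_length_eq_zero h).symm, fun h => h ▸ J.depth_self v⟩

lemma adj_parent {ξ v : V} (h : v ≠ ξ) : J.graph.Adj (J.parent ξ v) v := by
  obtain ⟨p, hadj, hp, -, -⟩ := J.path_last h
  rw [parent, ← hp]
  exact hadj

lemma path_eq_concat {ξ v : V} (h : v ≠ ξ) :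
    J.path ξ v = (J.path ξ (J.parent ξ v)).concat (J.adj_parent h) := by
  obtain ⟨p, hadj, hp, hc, -⟩ := J.path_last h
  subst hp
  exact hc

lemma notMem_path_parent {ξ v : V} (h : v ≠ ξ) : v ∉ (J.path ξ (J.parent ξ v)).support := by
  obtain ⟨p, hadj, hp, -, hn⟩ := J.path_last h
  subst hp
  exact hn

lemma depth_parent {ξ v : V} (h : v ≠ ξ) : J.depth ξ v = J.depth ξ (J.parent ξ v) + 1 := by
  rw [depth, J.path_eq_concat h, SimpleGraph.Walk.length_concat, depth]

lemma rho_parent {ξ v : V} (h : v ≠ ξ) :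
    J.rho ξ v = J.rho ξ (J.parent ξ v) + J.len s(J.parent ξ v, v) :=
  J.rho_step (J.adj_parent h) (J.notMem_path_parent h)

lemma mem_outer_iff_support {ξ u v : V} :
    u ∈ J.outerBranch ξ v ↔ v ∈ (J.path ξ u).support := Iff.rfl

lemma mem_outer_self (ξ v : V) : v ∈ J.outerBranch ξ v := (J.path ξ v).end_mem_support

lemma mem_outer_iff {ξ u v : V} :
    u ∈ J.outerBranch ξ v ↔ u = v ∨ (u ≠ ξ ∧ J.parent ξ u ∈ J.outerBranch ξ v) := by
  by_cases h : u = ξ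
  · subst h
    simp [outerBranch, J.path_self, eq_comm]
  · simp only [outerBranch, Set.mem_ofPred_eq]
    rw [J.path_eq_concat h, SimpleGraph.Walk.support_concat]
    simp [h, or_comm, eq_comm]

lemma outer_root (ξ : V) : J.outerBranch ξ ξ = Set.univ :=
  Set.eq_univ_of_forall fun v => (J.path ξ v).start_mem_support

lemma mem_outer_of_parent {ξ u v : V} (h : u ≠ ξ) (hp : J.parent ξ u ∈ J.outerBranch ξ v) :
    u ∈ J.outerBranch ξ v := J.mem_outer_iff.2 (Or.inr ⟨h, hp⟩)

/-- Induction along the path from the root. -/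
lemma root_induction (ξ : V) {P : V → Prop} (h0 : P ξ)
    (hs : ∀ v, v ≠ ξ → P (J.parent ξ v) → P v) (v : V) : P v := by
  induction hn : J.depth ξ v generalizing v with
  | zero => exact (J.depth_eq_zero.1 hn) ▸ h0
  | succ n ih =>
    have hv : v ≠ ξ := by
      rintro rfl
      simp [J.depth_self] at hn
    exact hs v hv (ih _ (by rw [J.depth_parent hv] at hn; omega))

/-- Induction along the path from `v` to a vertex of the branch with root `v`. -/
lemma outer_induction {ξ v : V} {P : V → Prop} (h0 : P v)
    (hs : ∀ u, u ≠ ξ → u ≠ v → J.parent ξ u ∈ J.outerBranch ξ v → P (J.parent ξ u) → P u)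
    {u : V} (hu : u ∈ J.outerBranch ξ v) : P u := by
  revert hu
  refine J.root_induction ξ (P := fun u => u ∈ J.outerBranch ξ v → P u) ?_ ?_ u
  · intro h
    rcases J.mem_outer_iff.1 h with h | h
    · exact h ▸ h0
    · exact absurd rfl h.1
  · intro u hu ih h
    by_cases huv : u = v
    · exact huv ▸ h0
    rcases J.mem_outer_iff.1 h with h | h
    · exact absurd h huv
    · exact hs u hu huv h.2 (ih h.2)

lemma depth_le_of_mem_outer {ξ u v : V} (h : u ∈ J.outerBranch ξ v) :
    J.depth ξ v ≤ J.depth ξ u := by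
  refine J.outer_induction (P := fun u => J.depth ξ v ≤ J.depth ξ u) le_rfl ?_ h
  intro u hu _ _ ih
  rw [J.depth_parent hu]
  omega

lemma eq_of_mem_outer_of_depth_le {ξ u v : V} (h : u ∈ J.outerBranch ξ v)
    (hd : J.depth ξ u ≤ J.depth ξ v) : u = v := by
  rcases J.mem_outer_iff.1 h with h | h
  · exact h
  · have := J.depth_le_of_mem_outer h.2
    rw [J.depth_parent h.1] at hd
    omega

lemma outer_subset {ξ u v : V} (h : u ∈ J.outerBranch ξ v) :
    J.outerBranch ξ u ⊆ J.outerBranch ξ v := fun _ hw =>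
  J.outer_induction h (fun _ hx _ _ ih => J.mem_outer_of_parent hx ih) hw

lemma outer_comparable {ξ u v w : V} (hv : u ∈ J.outerBranch ξ v) (hw : u ∈ J.outerBranch ξ w) :
    v ∈ J.outerBranch ξ w ∨ w ∈ J.outerBranch ξ v := by
  revert hw
  refine J.outer_induction (P := fun u => u ∈ J.outerBranch ξ w →
    v ∈ J.outerBranch ξ w ∨ w ∈ J.outerBranch ξ v) Or.inl ?_ hv
  intro u hu _ hpv ih hw
  rcases J.mem_outer_iff.1 hw with h | h
  · subst h
    exact Or.inr (J.mem_outer_of_parent hu hpv)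
  · exact ih h.2

lemma eq_of_mem_outer_of_depth_eq {ξ u v w : V} (hv : u ∈ J.outerBranch ξ v)
    (hw : u ∈ J.outerBranch ξ w) (hd : J.depth ξ v = J.depth ξ w) : v = w := by
  rcases J.outer_comparable hv hw with h | h
  · exact J.eq_of_mem_outer_of_depth_le h hd.le
  · exact (J.eq_of_mem_outer_of_depth_le h hd.ge).symm

/-- Every vertex has an ancestor at each smaller depth. -/
lemma exists_ancestor {ξ u : V} {n : ℕ} (hn : n ≤ J.depth ξ u) :
    ∃ v, J.depth ξ v = n ∧ u ∈ J.outerBranch ξ v := by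
  revert hn
  refine J.root_induction ξ (P := fun u => n ≤ J.depth ξ u →
    ∃ v, J.depth ξ v = n ∧ u ∈ J.outerBranch ξ v) ?_ ?_ u
  · intro hn
    rw [J.depth_self] at hn
    exact ⟨ξ, by rw [J.depth_self]; omega, J.mem_outer_self _ _⟩
  · intro u hu ih hn
    rcases hn.eq_or_lt with h | h
    · exact ⟨u, h.symm, J.mem_outer_self _ _⟩
    · rw [J.depth_parent hu] at h
      obtain ⟨v, hv, hm⟩ := ih (by omega)
      exact ⟨v, hv, J.mem_outer_of_parent hu hm⟩

lemma adj_cases (ξ : V) {a b : V} (h : J.graph.Adj a b) :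
    (b ≠ ξ ∧ J.parent ξ b = a) ∨ (a ≠ ξ ∧ J.parent ξ a = b) := by
  have key : ∀ {a b : V}, J.graph.Adj a b → b ∉ (J.path ξ a).support →
      b ≠ ξ ∧ J.parent ξ b = a := by
    intro a b h hb
    refine ⟨fun hbx => hb (hbx ▸ (J.path ξ a).start_mem_support), ?_⟩
    rw [parent, J.path_unique _ ((J.path_isPath ξ a).concat hb h)]
    simp
  by_cases hb : a ∈ J.outerBranch ξ b
  · refine Or.inr (key h.symm fun ha => h.ne ?_)
    exact J.eq_of_mem_outer_of_depth_le (J.mem_outer_iff_support.1 hb)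
      (J.depth_le_of_mem_outer (J.mem_outer_iff_support.2 ha))
  · exact Or.inl (key h hb)

/-! ### Children -/

variable {J} in
lemma IsLocallyFinite.finite_children (hlf : J.IsLocallyFinite) (ξ v : V) :
    {c | c ≠ ξ ∧ J.parent ξ c = v}.Finite := by
  refine (hlf.1 v).subset ?_
  rintro c ⟨hc, rfl⟩
  exact J.adj_parent hc

variable {J} (hlf : J.IsLocallyFinite)

/-- The neighbours of `v` that are farther from `ξ` than `v`. -/
def children (ξ v : V) : Finset V := (hlf.finite_children ξ v).toFinset

lemma mem_children {ξ v c : V} : c ∈ children hlf ξ v ↔ c ≠ ξ ∧ J.parent ξ c = v := by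
  simp [children]

lemma depth_child {ξ v c : V} (h : c ∈ children hlf ξ v) : J.depth ξ c = J.depth ξ v + 1 := by
  obtain ⟨h1, rfl⟩ := (mem_children hlf).1 h
  exact J.depth_parent h1

lemma child_mem_outer {ξ v c : V} (h : c ∈ children hlf ξ v) : c ∈ J.outerBranch ξ v := by
  obtain ⟨h1, rfl⟩ := (mem_children hlf).1 h
  exact J.mem_outer_of_parent h1 (J.mem_outer_self _ _)

lemma exists_child_of_mem_outer {ξ u v : V} (h : u ∈ J.outerBranch ξ v) (hne : u ≠ v) :
    ∃ c ∈ children hlf ξ v, u ∈ J.outerBranch ξ c := by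
  revert hne
  refine J.outer_induction (P := fun u => u ≠ v → ∃ c ∈ children hlf ξ v, u ∈ J.outerBranch ξ c)
    (fun h => absurd rfl h) ?_ h
  intro u hu _ _ ih hne
  by_cases hp : J.parent ξ u = v
  · exact ⟨u, (mem_children hlf).2 ⟨hu, hp⟩, J.mem_outer_self _ _⟩
  · obtain ⟨c, hc, hm⟩ := ih hp
    exact ⟨c, hc, J.mem_outer_of_parent hu hm⟩

lemma adj_iff_children (ξ : V) {a b : V} :
    J.graph.Adj a b ↔ b ∈ children hlf ξ a ∨ (a ≠ ξ ∧ J.parent ξ a = b) := by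
  constructor
  · intro h
    rw [mem_children]
    exact J.adj_cases ξ h
  · rintro (h | ⟨h, rfl⟩)
    · obtain ⟨h1, rfl⟩ := (mem_children hlf).1 h
      exact J.adj_parent h1
    · exact (J.adj_parent h).symm

lemma exists_two_children (hperf : J.IsPerfect) (ξ v : V) :
    ∃ b ∈ children hlf ξ v, ∃ c ∈ children hlf ξ v, b ≠ c := by
  have h3 := hperf v
  have hsub : J.graph.neighborSet v ⊆ insert (J.parent ξ v) (children hlf ξ v : Set V) := by
    intro b hb
    rcases (adj_iff_children hlf ξ).1 hb with h | ⟨-, h⟩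
    · exact Or.inr h
    · exact Or.inl h.symm
  have h4 := (h3.trans (Set.encard_le_encard hsub)).trans (Set.encard_insert_le _ _)
  rw [Set.encard_coe_eq_coe_finsetCard] at h4
  have h5 : 3 ≤ (children hlf ξ v).card + 1 := by exact_mod_cast h4
  obtain ⟨b, hb, c, hc, hne⟩ := Finset.one_lt_card.1 (show 1 < (children hlf ξ v).card by omega)
  exact ⟨b, hb, c, hc, hne⟩

include hlf in
lemma finite_depth_le (ξ : V) (n : ℕ) : {v | J.depth ξ v ≤ n}.Finite := by
  induction n with
  | zero =>
    refine (Set.finite_singleton ξ).subset fun v hv => ?_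
    exact J.depth_eq_zero.1 (Nat.le_zero.1 hv)
  | succ n ih =>
    refine (ih.union (ih.biUnion fun v _ => (children hlf ξ v).finite_toSet)).subset ?_
    intro v hv
    by_cases hvξ : v = ξ
    · left
      simp [hvξ, J.depth_self]
    · right
      refine Set.mem_biUnion (x := J.parent ξ v) ?_ ?_
      · have := J.depth_parent hvξ
        simp only [Set.mem_ofPred_eq] at hv ⊢
        omega
      · simp [mem_children, hvξ]

/-! ### Betweenness and isometries -/

variable (J) in
lemma rho_eq_add_of_mem {a b v : V} (h : v ∈ (J.path a b).support) :
    J.rho a b = J.rho a v + J.rho v b := by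
  classical
  have h1 := J.path_unique _ ((J.path_isPath a b).takeUntil h)
  have h2 := J.path_unique _ ((J.path_isPath a b).dropUntil h)
  have h3 := congrArg SimpleGraph.Walk.edges ((J.path a b).take_spec h)
  rw [SimpleGraph.Walk.edges_append] at h3
  rw [rho, rho, rho, h1, h2, ← List.sum_append, ← List.map_append, h3]

variable (J) in
lemma rho_nonneg (a b : V) : 0 ≤ J.rho a b := by
  refine List.sum_nonneg ?_
  intro x hx
  obtain ⟨e, he, rfl⟩ := List.mem_map.1 hx
  exact (J.len_pos e ((J.path a b).edges_subset_edgeSet he)).le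

variable (J) in
lemma len_parent_pos {ξ v : V} (h : v ≠ ξ) : 0 < J.len s(J.parent ξ v, v) :=
  J.len_pos _ (J.adj_parent h)

variable (J) in
lemma rho_pos {a b : V} (h : a ≠ b) : 0 < J.rho a b := by
  rw [J.rho_parent h.symm]
  linarith [J.rho_nonneg a (J.parent a b), J.len_parent_pos h.symm]

variable (J) in
lemma rho_lt_add_of_notMem {a v : V} (b : V) (h : v ∉ (J.path a b).support) :
    J.rho a b < J.rho a v + J.rho v b := by
  classical
  revert h
  refine J.root_induction a (P := fun b => v ∉ (J.path a b).support →
    J.rho a b < J.rho a v + J.rho v b) ?_ ?_ b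
  · intro h
    have hva : v ≠ a := by
      rintro rfl
      simp at h
    rw [J.rho_self]
    linarith [J.rho_pos hva, J.rho_pos hva.symm]
  · intro b hb ih h
    have hvb : v ≠ b := by
      rintro rfl
      simp at h
    have hp : v ∉ (J.path a (J.parent a b)).support := fun hm =>
      h (J.mem_outer_of_parent hb hm)
    by_cases hm : b ∈ (J.path v (J.parent a b)).support
    · have h1 : b ∈ (J.path a v).support := by
        have := J.path_support_subset ((J.path a v).reverse.append (J.path a (J.parent a b))) hm
        rw [SimpleGraph.Walk.mem_support_append_iff] at this
        rcases this with h | h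
        · simpa using h
        · exact absurd h (J.notMem_path_parent hb)
      rw [J.rho_eq_add_of_mem h1]
      linarith [J.rho_pos hvb, J.rho_pos hvb.symm]
    · rw [J.rho_parent hb, J.rho_step (J.adj_parent hb) hm]
      linarith [ih hp]

variable (J) in
/-- A vertex lies on a path exactly if the triangle inequality is an equality. Hence isometries
preserve paths. -/
lemma mem_path_iff {a b v : V} :
    v ∈ (J.path a b).support ↔ J.rho a b = J.rho a v + J.rho v b :=
  ⟨J.rho_eq_add_of_mem, fun h => by
    by_contra hn
    exact (J.rho_lt_add_of_notMem b hn).ne h⟩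

variable (J) in
lemma adj_iff_path {a b : V} :
    J.graph.Adj a b ↔ a ≠ b ∧ ∀ c ∈ (J.path a b).support, c = a ∨ c = b := by
  constructor
  · intro h
    refine ⟨h.ne, fun c hc => ?_⟩
    have := J.path_support_subset h.toWalk hc
    simpa using this
  · rintro ⟨hne, h⟩
    have hadj := J.adj_parent hne.symm
    rcases h (J.parent a b) (by simp [J.path_eq_concat hne.symm]) with h1 | h1
    · rwa [h1] at hadj
    · exact absurd h1 hadj.ne

section Isometry

variable {Γ : Type*} [Group Γ] [MulAction Γ V] (hΓ : J.ActsByIsometries Γ)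
include hΓ

lemma smul_mem_path_iff (γ : Γ) {a b v : V} :
    γ • v ∈ (J.path (γ • a) (γ • b)).support ↔ v ∈ (J.path a b).support := by
  simp only [mem_path_iff, hΓ γ]

lemma smul_adj_iff (γ : Γ) {a b : V} : J.graph.Adj (γ • a) (γ • b) ↔ J.graph.Adj a b := by
  rw [adj_iff_path, adj_iff_path]
  refine and_congr (by simp) ⟨fun h c hc => ?_, fun h c hc => ?_⟩
  · simpa using h (γ • c) ((smul_mem_path_iff hΓ γ).2 hc)
  · have := h (γ⁻¹ • c) ((smul_mem_path_iff hΓ γ).1 (by simpa using hc))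
    simpa [inv_smul_eq_iff] using this

end Isometry

end Tree

section Absolute

variable {V : Type*} (J : MetricTree V)

/-! ### Subtrees and branches -/

lemma isSubtree_of_parent_mem {ξ v : V} {S : Set V} (hv : v ∈ S)
    (h : ∀ u ∈ S, u ≠ v → u ≠ ξ ∧ J.parent ξ u ∈ S) : J.IsSubtree S := by
  rw [IsSubtree, SimpleGraph.connected_iff_exists_forall_reachable]
  refine ⟨⟨v, hv⟩, ?_⟩
  have key : ∀ u, ∀ hu : u ∈ S, (J.graph.induce S).Reachable ⟨v, hv⟩ ⟨u, hu⟩ := by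
    intro u
    refine J.root_induction ξ (P := fun u => ∀ hu : u ∈ S,
      (J.graph.induce S).Reachable ⟨v, hv⟩ ⟨u, hu⟩) ?_ ?_ u
    · intro hu
      by_cases huv : ξ = v
      · subst huv
        exact SimpleGraph.Reachable.refl _
      · exact absurd rfl (h ξ hu huv).1
    · intro u hu ih hm
      by_cases huv : u = v
      · subst huv
        exact SimpleGraph.Reachable.refl _
      · have hp := (h u hm huv).2
        refine (ih hp).trans (SimpleGraph.Adj.reachable ?_)
        exact J.adj_parent hu
  exact fun w => key w.1 w.2

lemma parent_mem_of_isSubtree {ξ u : V} {S : Set V} (hS : J.IsSubtree S) (hξ : ξ ∈ S)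
    (hu : u ∈ S) : J.parent ξ u ∈ S := by
  obtain ⟨w⟩ := hS.preconnected ⟨ξ, hξ⟩ ⟨u, hu⟩
  have hsub := J.path_support_subset (w.map (SimpleGraph.Embedding.induce S).toHom)
  have hp : J.parent ξ u ∈ (J.path ξ u).support := by
    by_cases h : u = ξ
    · subst h
      simp [parent, J.path_self]
    · simp [J.path_eq_concat h]
  have h1 := hsub hp
  rw [SimpleGraph.Walk.support_map, List.mem_map] at h1
  obtain ⟨x, -, hx⟩ := h1
  rw [← hx]
  exact x.2

lemma isSubtree_outer (ξ v : V) : J.IsSubtree (J.outerBranch ξ v) :=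
  J.isSubtree_of_parent_mem (J.mem_outer_self ξ v) fun _ hu hne =>
    (J.mem_outer_iff.1 hu).resolve_left hne

lemma cutEdges_outer {ξ v : V} (h : v ≠ ξ) :
    J.cutEdges (J.outerBranch ξ v) = {(v, J.parent ξ v)} := by
  ext ⟨a, b⟩
  simp only [cutEdges, Set.mem_ofPred_eq, Set.mem_singleton_iff, Prod.mk.injEq]
  constructor
  · rintro ⟨hadj, ha, hb⟩
    rcases J.adj_cases ξ hadj with ⟨h1, h2⟩ | ⟨h1, h2⟩
    · exact absurd (J.mem_outer_of_parent h1 (h2 ▸ ha)) hb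
    · rcases J.mem_outer_iff.1 ha with h3 | h3
      · exact ⟨h3, by rw [← h2, h3]⟩
      · exact absurd (h2 ▸ h3.2) hb
  · rintro ⟨rfl, rfl⟩
    refine ⟨(J.adj_parent h).symm, J.mem_outer_self _ _, fun hm => ?_⟩
    have := J.depth_le_of_mem_outer hm
    rw [J.depth_parent h] at this
    omega

lemma isBranch_outer {ξ v : V} (h : v ≠ ξ) : J.IsBranch (J.outerBranch ξ v) :=
  ⟨J.isSubtree_outer ξ v, (v, J.parent ξ v), by simp [J.cutEdges_outer h],
    by simp [J.cutEdges_outer h]⟩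

/-- If `p` lies in `S`, its parent does not, and no other edge joins `S` to its complement, then
`S` is the branch with root `p`. -/
lemma eq_outer_of_unique_cut {ξ p : V} {S : Set V} (hp : p ≠ ξ) (hpS : p ∈ S)
    (hqS : J.parent ξ p ∉ S)
    (huniq : ∀ u, u ≠ ξ → u ≠ p → (u ∈ S ↔ J.parent ξ u ∈ S)) :
    S = J.outerBranch ξ p := by
  have hin : ∀ u ∈ J.outerBranch ξ p, u ∈ S := fun u hu =>
    J.outer_induction hpS (fun x hx hne _ ih => (huniq x hx hne).2 ih) hu
  have hout : ∀ u, u ∉ J.outerBranch ξ p → (u ∈ S ↔ ξ ∈ S) := fun u =>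
    J.root_induction ξ (P := fun u => u ∉ J.outerBranch ξ p → (u ∈ S ↔ ξ ∈ S))
      (fun _ => Iff.rfl)
      (fun v hv ih hm => by
        have h1 : v ≠ p := by
          rintro rfl
          exact hm (J.mem_outer_self _ _)
        rw [huniq v hv h1]
        exact ih fun h => hm (J.mem_outer_of_parent hv h)) u
  have hq : J.parent ξ p ∉ J.outerBranch ξ p := fun h => hqS (hin _ h)
  have hξ : ξ ∉ S := fun h => hqS ((hout _ hq).2 h)
  ext u
  by_cases hu : u ∈ J.outerBranch ξ p
  · simp [hu, hin u hu]
  · simp [hu, hout u hu, hξ]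

/-- Up to complements, the branches are the sets `outerBranch ξ v`. -/
lemma isBranch_cases {S : Set V} (ξ : V) (hS : J.IsBranch S) :
    ∃ v, S = J.outerBranch ξ v ∨ S = (J.outerBranch ξ v)ᶜ := by
  obtain ⟨-, ⟨p, q⟩, ⟨hadj, hp, hq⟩, huniq⟩ := hS
  dsimp only at hadj hp hq
  rcases J.adj_cases ξ hadj with ⟨h1, h2⟩ | ⟨h1, h2⟩
  · refine ⟨q, Or.inr ?_⟩
    rw [← J.eq_outer_of_unique_cut (S := Sᶜ) h1 hq (by simpa [h2] using hp), compl_compl]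
    intro u hu hne
    simp only [Set.mem_compl_iff, not_iff_not]
    have hpu := J.adj_parent hu
    constructor <;> intro h <;> by_contra hn
    · have := huniq (u, J.parent ξ u) ⟨hpu.symm, h, hn⟩
      simp only [Prod.mk.injEq] at this
      have h3 := J.depth_parent h1
      have h4 := J.depth_parent hu
      rw [h2] at h3
      rw [this.2, this.1] at h4
      omega
    · have := huniq (J.parent ξ u, u) ⟨hpu, h, hn⟩
      simp only [Prod.mk.injEq] at this
      exact hne this.2
  · refine ⟨p, Or.inl (J.eq_outer_of_unique_cut h1 hp (by simpa [h2] using hq) ?_)⟩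
    intro u hu hne
    have hpu := J.adj_parent hu
    constructor <;> intro h <;> by_contra hn
    · have := huniq (u, J.parent ξ u) ⟨hpu.symm, h, hn⟩
      simp only [Prod.mk.injEq] at this
      exact hne this.1
    · have := huniq (J.parent ξ u, u) ⟨hpu, h, hn⟩
      simp only [Prod.mk.injEq] at this
      have h3 := J.depth_parent h1
      have h4 := J.depth_parent hu
      rw [h2] at h3
      rw [this.1, this.2] at h4
      omega

/-! ### Rays and balls of the absolute -/

/-- The ball of the absolute that corresponds to the branch with root `v` away from `ξ`; it is the
whole absolute for `v = ξ`. -/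
abbrev ball (ξ v : V) : Set J.Abs := J.ends (J.outerBranch ξ v)

variable {J}

/-- The ray obtained by removing the first `N` vertices. -/
def Ray.tail (a : J.Ray) (N : ℕ) : J.Ray :=
  ⟨fun i => a.1 (N + i), fun i j h => by simpa using a.2.1 h, fun i => a.2.2 (N + i)⟩

lemma Ray.toAbs_tail (a : J.Ray) (N : ℕ) : (a.tail N).toAbs = a.toAbs :=
  Quotient.sound ⟨0, N, fun i => by simp [Ray.tail]⟩

lemma toAbs_mem_ends_iff {a : J.Ray} {S : Set V} :
    a.toAbs ∈ J.ends S ↔ ∀ᶠ i in atTop, a.1 i ∈ S := by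
  constructor
  · rintro ⟨b, hb, hS⟩
    obtain ⟨m, n, h⟩ := Quotient.exact hb
    filter_upwards [eventually_ge_atTop n] with i hi
    obtain ⟨k, rfl⟩ := Nat.exists_eq_add_of_le hi
    rw [← h k]
    exact hS _
  · intro h
    obtain ⟨N, hN⟩ := eventually_atTop.1 h
    exact ⟨a.tail N, a.toAbs_tail N, fun i => hN _ (Nat.le_add_right _ _)⟩

lemma exists_ray (ω : J.Abs) : ∃ a : J.Ray, a.toAbs = ω := Quotient.exists_rep ω

/-- From some moment on, a ray moves away from `ξ`. -/
lemma Ray.eventually_descending (ξ : V) (a : J.Ray) :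
    ∃ N, ∀ i, N ≤ i → a.1 (i + 1) ≠ ξ ∧ J.parent ξ (a.1 (i + 1)) = a.1 i := by
  by_cases hex : ∃ N, a.1 (N + 1) ≠ ξ ∧ J.parent ξ (a.1 (N + 1)) = a.1 N
  · obtain ⟨N, hN⟩ := hex
    refine ⟨N, fun i hi => ?_⟩
    induction i, hi using Nat.le_induction with
    | base => exact hN
    | succ i _ ih =>
      -- once the ray has stepped to a child, stepping to the parent would repeat a vertex
      rcases J.adj_cases ξ (a.2.2 (i + 1)) with h | h
      · exact h
      · have := a.2.1 (ih.2.symm.trans h.2)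
        omega
  · -- otherwise the depth would decrease forever
    push Not at hex
    have hdesc : ∀ i, J.depth ξ (a.1 i) = J.depth ξ (a.1 (i + 1)) + 1 := by
      intro i
      rcases J.adj_cases ξ (a.2.2 i) with h | h
      · exact absurd h.2 (hex i h.1)
      · rw [J.depth_parent h.1, h.2]
    have hsum : ∀ i, J.depth ξ (a.1 0) = J.depth ξ (a.1 i) + i := by
      intro i
      induction i with
      | zero => rfl
      | succ i ih =>
        have := hdesc i
        omega
    have := hsum (J.depth ξ (a.1 0) + 1)
    omega

lemma Ray.depth_add {ξ : V} {a : J.Ray} {N : ℕ}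
    (hN : ∀ i, N ≤ i → a.1 (i + 1) ≠ ξ ∧ J.parent ξ (a.1 (i + 1)) = a.1 i) (i : ℕ) :
    J.depth ξ (a.1 (N + i)) = J.depth ξ (a.1 N) + i := by
  induction i with
  | zero => rfl
  | succ i ih =>
    have h := hN (N + i) (by omega)
    rw [show N + (i + 1) = N + i + 1 by omega, J.depth_parent h.1, h.2, ih]
    omega

lemma Ray.mem_outer_mono {ξ v : V} {a : J.Ray} {N : ℕ}
    (hN : ∀ i, N ≤ i → a.1 (i + 1) ≠ ξ ∧ J.parent ξ (a.1 (i + 1)) = a.1 i) {i j : ℕ}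
    (hi : N ≤ i) (hij : i ≤ j) (h : a.1 i ∈ J.outerBranch ξ v) : a.1 j ∈ J.outerBranch ξ v := by
  induction j, hij using Nat.le_induction with
  | base => exact h
  | succ j hij ih =>
    have h1 := hN j (hi.trans hij)
    exact J.mem_outer_of_parent h1.1 (h1.2 ▸ ih)

/-- A ray that does not end in the branch with root `v` eventually avoids it. -/
lemma toAbs_mem_ball_iff_frequently {ξ v : V} {a : J.Ray} :
    a.toAbs ∈ J.ball ξ v ↔ ∃ᶠ i in atTop, a.1 i ∈ J.outerBranch ξ v := by
  rw [toAbs_mem_ends_iff]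
  refine ⟨fun h => h.frequently, fun h => ?_⟩
  obtain ⟨N, hN⟩ := a.eventually_descending ξ
  obtain ⟨i, hi, hm⟩ := (frequently_atTop.1 h) N
  exact eventually_atTop.2 ⟨i, fun j hj => Ray.mem_outer_mono hN hi hj hm⟩

lemma ball_root (ξ : V) : J.ball ξ ξ = Set.univ := by
  refine Set.eq_univ_of_forall fun ω => ?_
  obtain ⟨a, rfl⟩ := exists_ray ω
  rw [toAbs_mem_ends_iff]
  simp [J.outer_root]

lemma ends_compl_outer (ξ v : V) : J.ends (J.outerBranch ξ v)ᶜ = (J.ball ξ v)ᶜ := by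
  ext ω
  obtain ⟨a, rfl⟩ := exists_ray ω
  rw [Set.mem_compl_iff, toAbs_mem_ball_iff_frequently, toAbs_mem_ends_iff, not_frequently]
  rfl

lemma ends_mono {S S' : Set V} (h : S ⊆ S') : J.ends S ⊆ J.ends S' :=
  fun _ ⟨a, ha, hS⟩ => ⟨a, ha, fun i => h (hS i)⟩

lemma disjoint_outer {ξ u v : V} (h1 : u ∉ J.outerBranch ξ v) (h2 : v ∉ J.outerBranch ξ u) :
    Disjoint (J.outerBranch ξ u) (J.outerBranch ξ v) := by
  refine Set.disjoint_left.2 fun w hu hv => ?_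
  rcases J.outer_comparable hu hv with h | h
  · exact h1 h
  · exact h2 h

lemma disjoint_ball {ξ u v : V} (h1 : u ∉ J.outerBranch ξ v) (h2 : v ∉ J.outerBranch ξ u) :
    Disjoint (J.ball ξ u) (J.ball ξ v) := by
  refine Set.disjoint_left.2 fun ω hu hv => ?_
  obtain ⟨a, rfl⟩ := exists_ray ω
  rw [toAbs_mem_ends_iff] at hu hv
  obtain ⟨i, hi⟩ := (hu.and hv).exists
  exact Set.disjoint_left.1 (disjoint_outer h1 h2) hi.1 hi.2

lemma disjoint_ball_of_depth_eq {ξ u v : V} (h : J.depth ξ u = J.depth ξ v) (hne : u ≠ v) :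
    Disjoint (J.ball ξ u) (J.ball ξ v) :=
  disjoint_ball (fun hm => hne (J.eq_of_mem_outer_of_depth_le hm h.le))
    fun hm => hne (J.eq_of_mem_outer_of_depth_le hm h.ge).symm

/-- At each depth, every point of the absolute lies in some ball. -/
lemma exists_mem_ball (ξ : V) (n : ℕ) (ω : J.Abs) : ∃ v, J.depth ξ v = n ∧ ω ∈ J.ball ξ v := by
  obtain ⟨a, rfl⟩ := exists_ray ω
  obtain ⟨N, hN⟩ := a.eventually_descending ξ
  obtain ⟨v, hv, hm⟩ := J.exists_ancestor (ξ := ξ) (u := a.1 (N + n)) (n := n)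
    (by rw [Ray.depth_add hN]; omega)
  refine ⟨v, hv, ?_⟩
  rw [toAbs_mem_ends_iff]
  exact eventually_atTop.2 ⟨N + n, fun j hj => Ray.mem_outer_mono hN (by omega) hj hm⟩

lemma ball_eq_biUnion_children (hlf : J.IsLocallyFinite) (ξ v : V) :
    J.ball ξ v = ⋃ c ∈ children hlf ξ v, J.ball ξ c := by
  refine Set.Subset.antisymm (fun ω hω => ?_) ?_
  · obtain ⟨c, hc, hm⟩ := exists_mem_ball ξ (J.depth ξ v + 1) ω
    obtain ⟨a, rfl⟩ := exists_ray ω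
    have hω' := toAbs_mem_ends_iff.1 hω
    obtain ⟨i, hi⟩ := (hω'.and (toAbs_mem_ends_iff.1 hm)).exists
    have hcv : c ∈ J.outerBranch ξ v := by
      rcases J.outer_comparable hi.1 hi.2 with h | h
      · have := J.depth_le_of_mem_outer h
        omega
      · exact h
    rcases J.mem_outer_iff.1 hcv with rfl | h
    · omega
    · have hp := J.depth_parent h.1
      have := J.eq_of_mem_outer_of_depth_le h.2 (by omega)
      exact Set.mem_biUnion ((mem_children hlf).2 ⟨h.1, this⟩) hm
  · exact Set.iUnion₂_subset fun c hc => ends_mono (J.outer_subset (child_mem_outer hlf hc))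

/-! ### The Borel sets of the absolute -/

lemma measurableSet_ball (ξ v : V) : MeasurableSet (J.ball ξ v) := by
  by_cases h : v = ξ
  · subst h
    rw [ball_root]
    exact MeasurableSet.univ
  · refine (MeasurableSpace.measurableSet_generateFrom ?_ : MeasurableSet[borel J.Abs] _)
    exact TopologicalSpace.isOpen_generateFrom_of_mem ⟨_, J.isBranch_outer h, rfl⟩

lemma measurableSpace_eq_generateFrom_balls [Countable V] (ξ : V) :
    (inferInstance : MeasurableSpace J.Abs) =
      MeasurableSpace.generateFrom (Set.range (J.ball ξ)) := by
  have hcount : {B : Set J.Abs | ∃ S, J.IsBranch S ∧ B = J.ends S}.Countable := by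
    refine ((Set.countable_range (J.ball ξ)).union
      (Set.countable_range fun v => (J.ball ξ v)ᶜ)).mono ?_
    rintro B ⟨S, hS, rfl⟩
    obtain ⟨v, rfl | rfl⟩ := J.isBranch_cases ξ hS
    · exact Or.inl ⟨v, rfl⟩
    · exact Or.inr ⟨v, (ends_compl_outer ξ v).symm⟩
  have hsc : SecondCountableTopology J.Abs := ⟨⟨_, hcount, rfl⟩⟩
  refine (borel_eq_generateFrom_of_subbasis (s := {B | ∃ S, J.IsBranch S ∧ B = J.ends S})
    rfl).trans (le_antisymm (MeasurableSpace.generateFrom_le ?_)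
      (MeasurableSpace.generateFrom_le ?_))
  · rintro B ⟨S, hS, rfl⟩
    obtain ⟨v, rfl | rfl⟩ := J.isBranch_cases ξ hS
    · exact MeasurableSpace.measurableSet_generateFrom ⟨v, rfl⟩
    · rw [ends_compl_outer]
      exact (MeasurableSpace.measurableSet_generateFrom (Set.mem_range_self v)).compl
  · rintro B ⟨v, rfl⟩
    by_cases h : v = ξ
    · subst h
      rw [ball_root]
      exact @MeasurableSet.univ _ (_)
    · exact MeasurableSpace.measurableSet_generateFrom ⟨_, J.isBranch_outer h, rfl⟩

/-- The inductive step from the children to the parent, at depths below `n`. -/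
lemma induction_up (hlf : J.IsLocallyFinite) (ξ : V) (n : ℕ) {P : V → Prop}
    (hdeep : ∀ v, n ≤ J.depth ξ v → P v)
    (hup : ∀ v, J.depth ξ v < n → (∀ c ∈ children hlf ξ v, P c) → P v) (v : V) : P v := by
  induction hk : n - J.depth ξ v generalizing v with
  | zero => exact hdeep v (by omega)
  | succ k ih =>
    refine hup v (by omega) fun c hc => ih c ?_
    rw [depth_child hlf hc]
    omega

/-- Large balls are finite unions of small ones, so the small ones generate the Borel sets. -/
lemma measurableSpace_eq_generateFrom_deep_balls [Countable V] (hlf : J.IsLocallyFinite)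
    (ξ : V) (n : ℕ) : (inferInstance : MeasurableSpace J.Abs) =
      MeasurableSpace.generateFrom {B | ∃ v, n ≤ J.depth ξ v ∧ B = J.ball ξ v} := by
  rw [measurableSpace_eq_generateFrom_balls ξ]
  refine le_antisymm (MeasurableSpace.generateFrom_le ?_) (MeasurableSpace.generateFrom_mono ?_)
  · rintro B ⟨v, rfl⟩
    refine induction_up hlf ξ n (P := fun v => MeasurableSet[MeasurableSpace.generateFrom
      {B | ∃ v, n ≤ J.depth ξ v ∧ B = J.ball ξ v}] (J.ball ξ v)) ?_ ?_ v
    · exact fun v hv => MeasurableSpace.measurableSet_generateFrom ⟨v, hv, rfl⟩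
    · intro v _ ih
      rw [ball_eq_biUnion_children hlf]
      exact Finset.measurableSet_biUnion _ ih
  · rintro B ⟨v, -, rfl⟩
    exact ⟨v, rfl⟩

lemma isPiSystem_deep_balls (ξ : V) (n : ℕ) :
    IsPiSystem {B | ∃ v, n ≤ J.depth ξ v ∧ B = J.ball ξ v} := by
  rintro _ ⟨u, hu, rfl⟩ _ ⟨v, hv, rfl⟩ hne
  by_cases h1 : u ∈ J.outerBranch ξ v
  · exact ⟨u, hu, Set.inter_eq_left.2 (ends_mono (J.outer_subset h1))⟩
  by_cases h2 : v ∈ J.outerBranch ξ u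
  · exact ⟨v, hv, Set.inter_eq_right.2 (ends_mono (J.outer_subset h2))⟩
  · exact absurd (Set.disjoint_iff_inter_eq_empty.1 (disjoint_ball h1 h2)) hne.ne_empty

/-! ### Flows -/

/-- A function on the vertices whose value at each vertex is the sum of its values at the
children. The values of a charge on the balls form a flow. -/
def IsFlow (hlf : J.IsLocallyFinite) (ξ : V) (h : V → ℝ) : Prop :=
  ∀ v, h v = ∑ c ∈ children hlf ξ v, h c

lemma isFlow_charge (hlf : J.IsLocallyFinite) (ξ : V) (μ : SignedMeasure J.Abs) :
    IsFlow hlf ξ fun v => μ (J.ball ξ v) := by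
  intro v
  have hdisj : Set.PairwiseDisjoint (children hlf ξ v : Set V) (J.ball ξ) := by
    intro b hb c hc hne
    refine disjoint_ball_of_depth_eq ?_ hne
    rw [depth_child hlf hb, depth_child hlf hc]
  simp only
  rw [ball_eq_biUnion_children hlf,
    VectorMeasure.of_biUnion_finset hdisj fun c _ => measurableSet_ball ξ c]

variable {hlf : J.IsLocallyFinite} {ξ : V}

lemma IsFlow.eq_of_deep {h h' : V → ℝ} (hf : IsFlow hlf ξ h) (hf' : IsFlow hlf ξ h') (n : ℕ)
    (hd : ∀ v, n ≤ J.depth ξ v → h v = h' v) (v : V) : h v = h' v :=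
  induction_up hlf ξ n (P := fun v => h v = h' v) hd
    (fun v _ ih => by rw [hf v, hf' v]; exact Finset.sum_congr rfl ih) v

/-- A flow that vanishes at depth `n` vanishes at all smaller depths. -/
lemma IsFlow.eq_zero_of_le {h : V → ℝ} (hf : IsFlow hlf ξ h) {n : ℕ}
    (hd : ∀ v, J.depth ξ v = n → h v = 0) {v : V} (hv : J.depth ξ v ≤ n) : h v = 0 := by
  revert hv
  refine induction_up hlf ξ n (P := fun v => J.depth ξ v ≤ n → h v = 0)
    (fun v h1 h2 => hd v (h2.antisymm h1)) (fun v hv ih _ => ?_) v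
  rw [hf v]
  refine Finset.sum_eq_zero fun c hc => ih c hc ?_
  rw [depth_child hlf hc]
  omega

/-- A charge is determined by its values on the balls of large depth. -/
lemma charge_ext [Countable V] (hlf : J.IsLocallyFinite) (ξ : V) (n : ℕ)
    {μ ν : SignedMeasure J.Abs}
    (h : ∀ v, n ≤ J.depth ξ v → μ (J.ball ξ v) = ν (J.ball ξ v)) : μ = ν := by
  refine VectorMeasure.ext_of_generateFrom _ ?_
    (measurableSpace_eq_generateFrom_deep_balls hlf ξ n) (isPiSystem_deep_balls ξ n) ?_
  · rintro _ ⟨v, hv, rfl⟩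
    exact h v hv
  · have := (isFlow_charge hlf ξ μ).eq_of_deep (isFlow_charge hlf ξ ν) n h ξ
    simpa only [ball_root] using this

end Absolute

section ChargeOfFlow

variable {V : Type*} {J : MetricTree V} {hlf : J.IsLocallyFinite} {ξ : V}

/-! ### Charges with prescribed values on the balls -/

variable (J ξ) in
/-- A function on the vertices may be prescribed by its increments along the edges. -/
lemma exists_of_increments (s : V → ℝ) :
    ∃ α : V → ℝ, α ξ = 0 ∧ ∀ v, v ≠ ξ → α v = α (J.parent ξ v) + s v := by
  classical
  refine ⟨fun v => ((J.path ξ v).support.map fun u => if u = ξ then 0 else s u).sum, ?_, ?_⟩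
  · simp [J.path_self]
  · intro v hv
    simp only
    rw [J.path_eq_concat hv, SimpleGraph.Walk.support_concat]
    simp [hv]

/-- The intervals of lengths `m c`, placed side by side in the order given by `e`, cover. -/
lemma exists_mem_Ico_partial_sums {ι : Type*} (e : ι → ℕ) (he : Function.Injective e)
    (m : ι → ℝ) (C : Finset ι) {t : ℝ} (h0 : 0 ≤ t) (ht : t < ∑ c ∈ C, m c) :
    ∃ c ∈ C, t ∈ Set.Ico (∑ b ∈ C with e b < e c, m b) ((∑ b ∈ C with e b < e c, m b) + m c) := by
  classical
  induction C using Finset.induction_on_max_value e with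
  | empty => simp at ht; linarith
  | insert a s has hmax ih =>
    by_cases hts : t < ∑ c ∈ s, m c
    · obtain ⟨c, hc, h⟩ := ih hts
      refine ⟨c, Finset.mem_insert_of_mem hc, ?_⟩
      rw [Finset.filter_insert, if_neg (not_lt.2 (hmax c hc))]
      exact h
    · refine ⟨a, Finset.mem_insert_self _ _, ?_⟩
      rw [Finset.filter_insert, if_neg (lt_irrefl _), Finset.filter_true_of_mem]
      · rw [Finset.sum_insert has] at ht
        exact ⟨not_lt.1 hts, by linarith⟩
      · intro x hx
        exact (hmax x hx).lt_of_ne fun h => has (he h ▸ hx)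

/-- A family of half-open intervals, indexed by the vertices, such that the intervals of the
children of a vertex subdivide the interval of the vertex. -/
structure IntervalFamily (hlf : J.IsLocallyFinite) (ξ : V) (I : V → Set ℝ) : Prop where
  subset : ∀ v, v ≠ ξ → I v ⊆ I (J.parent ξ v)
  exists_child : ∀ v, ∀ t ∈ I v, ∃ c ∈ children hlf ξ v, t ∈ I c
  unique : ∀ v, ∀ b ∈ children hlf ξ v, ∀ c ∈ children hlf ξ v, ∀ t, t ∈ I b → t ∈ I c → b = c

/-- The intervals have the lengths `h v`. Those of siblings are placed side by side, in the order
of an enumeration `e` of the vertices. -/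
lemma exists_intervalFamily [Countable V] {h : V → ℝ} (hf : IsFlow hlf ξ h) (hpos : ∀ v, 0 ≤ h v) :
    ∃ α : V → ℝ, α ξ = 0 ∧ IntervalFamily hlf ξ fun v => Set.Ico (α v) (α v + h v) := by
  obtain ⟨e, he⟩ := exists_injective_nat V
  obtain ⟨α, hα0, hα⟩ := J.exists_of_increments ξ
    fun v => ∑ b ∈ children hlf ξ (J.parent ξ v) with e b < e v, h b
  refine ⟨α, hα0, ?_, ?_, ?_⟩
  · intro v hv
    have hmem : v ∈ children hlf ξ (J.parent ξ v) := (mem_children hlf).2 ⟨hv, rfl⟩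
    have h1 : 0 ≤ ∑ b ∈ children hlf ξ (J.parent ξ v) with e b < e v, h b :=
      Finset.sum_nonneg fun b _ => hpos b
    have h2 : (∑ b ∈ children hlf ξ (J.parent ξ v) with e b < e v, h b) + h v
        ≤ h (J.parent ξ v) := by
      classical
      rw [hf (J.parent ξ v), add_comm, ← Finset.sum_insert (by simp)]
      refine Finset.sum_le_sum_of_subset_of_nonneg ?_ fun b _ _ => hpos b
      exact Finset.insert_subset hmem (Finset.filter_subset _ _)
    have h3 := hα v hv
    exact Set.Ico_subset_Ico (by linarith) (by linarith)
  · rintro v t ⟨ht1, ht2⟩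
    obtain ⟨c, hc, hm1, hm2⟩ := exists_mem_Ico_partial_sums e he h (children hlf ξ v)
      (t := t - α v) (by linarith) (by rw [← hf v]; linarith)
    obtain ⟨hcξ, rfl⟩ := (mem_children hlf).1 hc
    refine ⟨c, hc, ?_⟩
    have := hα c hcξ
    exact ⟨by linarith, by linarith⟩
  · have key : ∀ v, ∀ b ∈ children hlf ξ v, ∀ c ∈ children hlf ξ v, e b < e c →
        α b + h b ≤ α c := by
      intro v b hb c hc hlt
      obtain ⟨hbξ, hbv⟩ := (mem_children hlf).1 hb
      obtain ⟨hcξ, hcv⟩ := (mem_children hlf).1 hc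
      rw [hα b hbξ, hα c hcξ, hbv, hcv, add_assoc]
      gcongr
      classical
      rw [add_comm, ← Finset.sum_insert (by simp)]
      refine Finset.sum_le_sum_of_subset_of_nonneg ?_ fun b _ _ => hpos b
      intro x hx
      rcases Finset.mem_insert.1 hx with rfl | hx
      · simp [hb, hlt]
      · rw [Finset.mem_filter] at hx ⊢
        exact ⟨hx.1, hx.2.trans hlt⟩
    rintro v b hb c hc t ⟨hb1, hb2⟩ ⟨hc1, hc2⟩
    rcases lt_trichotomy (e b) (e c) with hlt | heq | hlt
    · linarith [key v b hb c hc hlt]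
    · exact he heq
    · linarith [key v c hc b hb hlt]

/-- A number in the interval of the root lies in the intervals along exactly one ray. -/
lemma IntervalFamily.exists_end {I : V → Set ℝ} (hI : IntervalFamily hlf ξ I) {t : ℝ}
    (ht : t ∈ I ξ) : ∃ ω : J.Abs, ∀ v, ω ∈ J.ball ξ v ↔ t ∈ I v := by
  choose f hf using hI.exists_child
  let x : ℕ → {v // t ∈ I v} := fun n => n.rec ⟨ξ, ht⟩ fun _ v => ⟨f v.1 t v.2, (hf v.1 t v.2).2⟩
  have hx : ∀ n, (x (n + 1)).1 ∈ children hlf ξ (x n).1 := fun n => (hf (x n).1 t (x n).2).1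
  have hdepth : ∀ n, J.depth ξ (x n).1 = n := by
    intro n
    induction n with
    | zero => exact J.depth_self ξ
    | succ n ih => rw [depth_child hlf (hx n), ih]
  let a : J.Ray := ⟨fun n => (x n).1,
    fun m n h => by rw [← hdepth m, ← hdepth n]; exact congrArg _ h,
    fun n => (adj_iff_children hlf ξ).2 (Or.inl (hx n))⟩
  have hsub : ∀ {u v}, u ∈ J.outerBranch ξ v → I u ⊆ I v := fun hu =>
    J.outer_induction Set.Subset.rfl (fun w hw _ _ ih => (hI.subset w hw).trans ih) hu
  have huniq : ∀ v, t ∈ I v → v = (x (J.depth ξ v)).1 := by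
    intro v
    refine J.root_induction ξ (P := fun v => t ∈ I v → v = (x (J.depth ξ v)).1) ?_ ?_ v
    · intro _
      simp [J.depth_self, x]
    · intro v hv ih hm
      have h1 := ih (hI.subset v hv hm)
      have h2 := hx (J.depth ξ (J.parent ξ v))
      rw [← h1, ← J.depth_parent hv] at h2
      exact hI.unique _ v ((mem_children hlf).2 ⟨hv, rfl⟩) _ h2 t hm (x _).2
  have hdesc : ∀ m n, m ≤ n → (x n).1 ∈ J.outerBranch ξ (x m).1 := by
    intro m n hmn
    induction n, hmn using Nat.le_induction with
    | base => exact J.mem_outer_self _ _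
    | succ n _ ih =>
      have := (mem_children hlf).1 (hx n)
      exact J.mem_outer_of_parent this.1 (this.2 ▸ ih)
  refine ⟨a.toAbs, fun v => ?_⟩
  rw [toAbs_mem_ends_iff]
  constructor
  · intro h
    obtain ⟨i, hi⟩ := h.exists
    exact hsub hi (x i).2
  · intro h
    refine eventually_atTop.2 ⟨J.depth ξ v, fun n hn => ?_⟩
    have := hdesc _ _ hn
    rwa [← huniq v h] at this

/-- A nonnegative flow is given by a measure on the absolute: the image of Lebesgue measure under
the map that sends a number to the ray along which the intervals contain it. -/
lemma exists_charge_of_nonneg_flow [Countable V] {h : V → ℝ} (hf : IsFlow hlf ξ h)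
    (hpos : ∀ v, 0 ≤ h v) : ∃ μ : SignedMeasure J.Abs, ∀ v, μ (J.ball ξ v) = h v := by
  obtain ⟨α, hα, hI⟩ := exists_intervalFamily hf hpos
  have hsub : ∀ v, Set.Ico (α v) (α v + h v) ⊆ Set.Ico (α ξ) (α ξ + h ξ) := fun v =>
    J.root_induction ξ (P := fun v => Set.Ico (α v) (α v + h v) ⊆ Set.Ico (α ξ) (α ξ + h ξ))
      Set.Subset.rfl (fun w hw ih => (hI.subset w hw).trans ih) v
  choose X hX using fun t : Set.Ico (α ξ) (α ξ + h ξ) => hI.exists_end t.2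
  have hpre : ∀ v, X ⁻¹' J.ball ξ v = Subtype.val ⁻¹' Set.Ico (α v) (α v + h v) := by
    intro v
    ext t
    exact hX t v
  have hmeas : Measurable X := by
    refine Measurable.mono (measurable_generateFrom ?_) le_rfl
      (measurableSpace_eq_generateFrom_balls (J := J) ξ).le
    rintro _ ⟨v, rfl⟩
    rw [hpre]
    exact measurable_subtype_coe measurableSet_Ico
  let P : Measure (Set.Ico (α ξ) (α ξ + h ξ)) := Measure.comap Subtype.val volume
  have hP : ∀ v, (P.map X) (J.ball ξ v) = ENNReal.ofReal (h v) := by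
    intro v
    rw [Measure.map_apply hmeas (measurableSet_ball ξ v), hpre,
      comap_subtype_coe_apply measurableSet_Ico, Subtype.image_preimage_coe,
      Set.inter_eq_right.2 (hsub v), Real.volume_Ico]
    simp
  have hfin : IsFiniteMeasure (P.map X) := by
    refine ⟨?_⟩
    rw [← ball_root ξ, hP]
    exact ENNReal.ofReal_lt_top
  refine ⟨(P.map X).toSignedMeasure, fun v => ?_⟩
  rw [Measure.toSignedMeasure_apply_measurable (measurableSet_ball ξ v), measureReal_def, hP,
    ENNReal.toReal_ofReal (hpos v)]

/-- The values of a charge can be prescribed at the large depths only. -/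
lemma exists_charge_of_nonneg_deep [Countable V] (n : ℕ) {h : V → ℝ}
    (hf : ∀ v, n ≤ J.depth ξ v → h v = ∑ c ∈ children hlf ξ v, h c)
    (hpos : ∀ v, n ≤ J.depth ξ v → 0 ≤ h v) :
    ∃ μ : SignedMeasure J.Abs, ∀ v, n ≤ J.depth ξ v → μ (J.ball ξ v) = h v := by
  classical
  induction n generalizing h with
  | zero =>
    obtain ⟨μ, hμ⟩ := exists_charge_of_nonneg_flow (fun v => hf v (Nat.zero_le _))
      fun v => hpos v (Nat.zero_le _)
    exact ⟨μ, fun v _ => hμ v⟩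
  | succ n ih =>
    -- correct the values at depth `n` so that the flow condition holds there too
    let k : V → ℝ := fun v => if J.depth ξ v = n then ∑ c ∈ children hlf ξ v, h c else h v
    have hk : ∀ v, J.depth ξ v ≠ n → k v = h v := fun v hv => if_neg hv
    have hkc : ∀ v, n ≤ J.depth ξ v → ∀ c ∈ children hlf ξ v, k c = h c := fun v hv c hc =>
      hk c (by rw [depth_child hlf hc]; omega)
    obtain ⟨μ, hμ⟩ := ih (h := k)
      (fun v hv => by
        rw [Finset.sum_congr rfl (hkc v hv)]
        by_cases hn : J.depth ξ v = n
        · exact if_pos hn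
        · rw [hk v hn]
          exact hf v (by omega))
      (fun v hv => by
        by_cases hn : J.depth ξ v = n
        · rw [show k v = _ from if_pos hn]
          exact Finset.sum_nonneg fun c hc => hpos c (by rw [depth_child hlf hc]; omega)
        · rw [hk v hn]
          exact hpos v (by omega))
    exact ⟨μ, fun v hv => by rw [hμ v (by omega), hk v (by omega)]⟩

/-- Taking positive parts commutes with sums of numbers that have no opposite signs. -/
lemma max_zero_eq_sum {ι : Type*} {C : Finset ι} {h : ι → ℝ}
    (hs : ∀ b ∈ C, ∀ c ∈ C, 0 ≤ h b * h c) :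
    max (∑ c ∈ C, h c) 0 = ∑ c ∈ C, max (h c) 0 := by
  by_cases hneg : ∃ b ∈ C, h b < 0
  · obtain ⟨b, hb, hb0⟩ := hneg
    have hc : ∀ c ∈ C, h c ≤ 0 := fun c hc => by
      by_contra hn
      exact (hs b hb c hc).not_gt (mul_neg_of_neg_of_pos hb0 (not_le.1 hn))
    rw [max_eq_right (Finset.sum_nonpos hc), Finset.sum_eq_zero fun c h' => max_eq_right (hc c h')]
  · push Not at hneg
    rw [max_eq_left (Finset.sum_nonneg hneg)]
    exact Finset.sum_congr rfl fun c hc => (max_eq_left (hneg c hc)).symm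

/-- A flow is given by a charge if, at depths greater than `n`, its values at siblings never have
opposite signs: at these depths its positive and negative parts are flows. -/
lemma IsFlow.exists_charge [Countable V] {h : V → ℝ} (hf : IsFlow hlf ξ h) (n : ℕ)
    (hs : ∀ v, n ≤ J.depth ξ v → ∀ b ∈ children hlf ξ v, ∀ c ∈ children hlf ξ v, 0 ≤ h b * h c) :
    ∃ μ : SignedMeasure J.Abs, ∀ v, μ (J.ball ξ v) = h v := by
  obtain ⟨μ, hμ⟩ := exists_charge_of_nonneg_deep (hlf := hlf) n (h := fun v => max (h v) 0)
    (fun v hv => by rw [hf v, max_zero_eq_sum (hs v hv)]) fun v _ => le_max_right _ _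
  obtain ⟨ν, hν⟩ := exists_charge_of_nonneg_deep (hlf := hlf) n (h := fun v => max (-h v) 0)
    (fun v hv => by
      rw [hf v, ← Finset.sum_neg_distrib, max_zero_eq_sum]
      intro b hb c hc
      rw [neg_mul_neg]
      exact hs v hv b hb c hc) fun v _ => le_max_right _ _
  refine ⟨μ - ν, (isFlow_charge hlf ξ _).eq_of_deep hf n fun v hv => ?_⟩
  rw [_root_.sub_apply, hμ v hv, hν v hv]
  exact max_zero_sub_max_neg_zero_eq_self _

end ChargeOfFlow

section Embedding

variable {V : Type*} (J : MetricTree V)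

/-! ### The vectors `Ψ[μ|R]` in coordinates -/

/-- The coordinate of the vectors `f_a` at the vertices `v` of the path from `ξ` to `a`. -/
def coef (ξ : V) (lam : ℝ) (v : V) : ℝ := J.stepCoeff ξ lam v * lam ^ (-J.rho ξ v)

variable {ξ : V} {lam : ℝ}

lemma coef_pos (h0 : 0 < lam) (h1 : lam < 1) (v : V) : 0 < J.coef ξ lam v := by
  refine mul_pos ?_ (Real.rpow_pos_of_pos h0 _)
  rw [stepCoeff]
  split_ifs with h
  · exact one_pos
  · refine Real.sqrt_pos.2 (sub_pos.2 (Real.rpow_lt_one h0.le h1 ?_))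
    have := J.len_parent_pos h
    exact mul_pos two_pos this

lemma coef_sq (h0 : 0 < lam) (h1 : lam < 1) {v : V} (h : v ≠ ξ) :
    J.coef ξ lam v ^ 2 =
      lam ^ (-(2 * J.rho ξ v)) - lam ^ (-(2 * J.rho ξ (J.parent ξ v))) := by
  have hlen := J.len_parent_pos h
  rw [coef, stepCoeff, if_neg h, mul_pow, Real.sq_sqrt]
  · rw [← Real.rpow_natCast, ← Real.rpow_mul h0.le, sub_mul, ← Real.rpow_add h0, one_mul,
      J.rho_parent h, parent]
    congr 2 <;> push_cast <;> ring
  · exact sub_nonneg.2 (Real.rpow_le_one h0.le h1.le (mul_pos two_pos hlen).le)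

open Classical in
lemma normVec_apply (h0 : 0 < lam) (a v : V) :
    (J.normVec ξ lam a : lp (fun _ : V => ℝ) 2) v =
      if a ∈ J.outerBranch ξ v then J.coef ξ lam v else 0 := by
  have h : (J.normVec ξ lam a : lp (fun _ : V => ℝ) 2) v =
      lam ^ (-J.rho ξ a) * ∑ w ∈ (J.path ξ a).support.toFinset,
        (lp.single (E := fun _ : V => ℝ) 2 w (J.stepCoeff ξ lam w * lam ^ J.rho w a)) v := by
    change lam ^ (-J.rho ξ a) * J.ambientVec ξ lam a v = _
    rw [ambientVec, lp.coeFn_sum, Finset.sum_apply]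
  rw [h]
  simp only [lp.coeFn_single, Pi.single_apply]
  rw [Finset.sum_ite_eq]
  simp only [List.mem_toFinset, mem_outer_iff_support]
  split_ifs with hm
  · rw [coef, J.rho_eq_add_of_mem hm, neg_add, Real.rpow_add h0, Real.rpow_neg h0.le (J.rho v a)]
    have := (Real.rpow_pos_of_pos h0 (J.rho v a)).ne'
    field_simp
  · simp

/-! ### Complete subtrees -/

variable {J}

lemma mem_of_mem_outer {S : Set V} (hS : J.IsSubtree S) (hξ : ξ ∈ S) {u v : V} (hu : u ∈ S)
    (h : u ∈ J.outerBranch ξ v) : v ∈ S := by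
  revert hu
  refine J.outer_induction (P := fun u => u ∈ S → v ∈ S) id (fun u _ _ _ ih hu => ih ?_) h
  exact J.parent_mem_of_isSubtree hS hξ hu

open Classical in
/-- A flow through a vertex `v` of a complete subtree leaves it through the vertices of the boundary
that lie beyond `v`. -/
lemma sum_boundary (hlf : J.IsLocallyFinite) (hperf : J.IsPerfect) (R : J.CompleteSubtree ξ)
    {h : V → ℝ} (hf : IsFlow hlf ξ h) (v : V) :
    (∑ u ∈ J.boundary R.1, if u ∈ J.outerBranch ξ v then h u else 0) =
      if v ∈ R.1 then h v else 0 := by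
  obtain ⟨R, hsub, hcomp, hξ, hξn⟩ := R
  simp only
  split_ifs with hv
  swap
  · refine Finset.sum_eq_zero fun u hu => if_neg fun hm => hv ?_
    have huR : u ∈ R := (Finset.mem_filter.1 hu).1
    exact mem_of_mem_outer (S := (R : Set V)) hsub hξ huR hm
  obtain ⟨n, hn⟩ : ∃ n, ∀ v ∈ R, J.depth ξ v < n :=
    ⟨R.sup (J.depth ξ) + 1, fun v hv => Nat.lt_succ_of_le (Finset.le_sup hv)⟩
  revert hv
  refine induction_up hlf ξ n (P := fun v => v ∈ R →
    (∑ u ∈ J.boundary R, if u ∈ J.outerBranch ξ v then h u else 0) = h v)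
    (fun v h1 h2 => absurd (hn v h2) (not_lt.2 h1)) (fun v _ ih hv => ?_) v
  -- all neighbours of `v` lie in `R`, or only its parent does and `v` is on the boundary
  rcases hcomp v hv with hall | ⟨q, ⟨-, hqR⟩, hq⟩
  · rw [hf v, ← Finset.sum_congr rfl fun c hc =>
      ih c hc (hall c ((adj_iff_children hlf ξ).2 (Or.inl hc))), Finset.sum_comm]
    refine Finset.sum_congr rfl fun u hu => ?_
    have huv : u ≠ v := by
      rintro rfl
      obtain ⟨b, hb, hbR⟩ := (Finset.mem_filter.1 hu).2
      exact hbR (hall b hb)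
    split_ifs with hm
    · obtain ⟨c, hc, hmc⟩ := exists_child_of_mem_outer hlf hm huv
      rw [Finset.sum_eq_single_of_mem c hc, if_pos hmc]
      intro b hb hbc
      refine if_neg fun hmb => hbc (J.eq_of_mem_outer_of_depth_eq hmb hmc ?_)
      rw [depth_child hlf hb, depth_child hlf hc]
    · exact (Finset.sum_eq_zero fun c hc => if_neg fun hmc =>
        hm (J.outer_subset (child_mem_outer hlf hc) hmc)).symm
  · have hadjc : ∀ c ∈ children hlf ξ v, J.graph.Adj v c := fun c hc =>
      (adj_iff_children hlf ξ).2 (Or.inl hc)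
    obtain ⟨b, hb, c, hc, hbc⟩ := exists_two_children hlf hperf ξ v
    have hvξ : v ≠ ξ := by
      rintro rfl
      exact hbc ((hq b ⟨hadjc b hb, hξn b (hadjc b hb)⟩).trans
        (hq c ⟨hadjc c hc, hξn c (hadjc c hc)⟩).symm)
    have hpq := hq (J.parent ξ v) ⟨(J.adj_parent hvξ).symm,
      J.parent_mem_of_isSubtree (S := (R : Set V)) hsub hξ hv⟩
    have hcR : ∀ c ∈ children hlf ξ v, c ∉ R := by
      intro c hc hcR
      have h1 := (hq c ⟨hadjc c hc, hcR⟩).trans hpq.symm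
      have h2 := depth_child hlf hc
      rw [h1, J.depth_parent hvξ] at h2
      omega
    have hvb : v ∈ J.boundary R := Finset.mem_filter.2 ⟨hv, b, hadjc b hb, hcR b hb⟩
    rw [Finset.sum_eq_single_of_mem v hvb, if_pos (J.mem_outer_self _ _)]
    intro u hu huv
    refine if_neg fun hm => ?_
    obtain ⟨c, hc, hmc⟩ := exists_child_of_mem_outer hlf hm huv
    exact hcR c hc (mem_of_mem_outer (S := (R : Set V)) hsub hξ (Finset.mem_filter.1 hu).1 hmc)

open Classical in
lemma psiOn_apply (hlf : J.IsLocallyFinite) (hperf : J.IsPerfect) (h0 : 0 < lam)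
    (R : J.CompleteSubtree ξ) (μ : SignedMeasure J.Abs) (v : V) :
    (J.psiOn ξ lam R μ : lp (fun _ : V => ℝ) 2) v =
      if v ∈ R.1 then J.coef ξ lam v * μ (J.ball ξ v) else 0 := by
  have h : (J.psiOn ξ lam R μ : lp (fun _ : V => ℝ) 2) v =
      ∑ u ∈ J.boundary R.1, μ (J.ball ξ u) *
        (J.normVec ξ lam u : lp (fun _ : V => ℝ) 2) v := by
    rw [psiOn, Submodule.coe_sum, lp.coeFn_sum, Finset.sum_apply]
    rfl
  have h2 := sum_boundary hlf hperf R (isFlow_charge hlf ξ μ) v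
  rw [h, ← mul_ite_zero, ← h2, Finset.mul_sum]
  refine Finset.sum_congr rfl fun u _ => ?_
  rw [J.normVec_apply h0]
  split_ifs
  · ring
  · simp

/-- The vertices at distance at most `n + 1` from `ξ` form a complete subtree. -/
def levelSubtree (hlf : J.IsLocallyFinite) (ξ : V) (n : ℕ) : J.CompleteSubtree ξ :=
  ⟨(finite_depth_le hlf ξ (n + 1)).toFinset, by
    refine ⟨J.isSubtree_of_parent_mem (ξ := ξ) (v := ξ) (by simp [J.depth_self]) ?_, ?_, ?_, ?_⟩
    · intro u hu hne
      refine ⟨hne, ?_⟩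
      simp only [Set.Finite.coe_toFinset, Set.mem_ofPred_eq] at hu ⊢
      have := J.depth_parent hne
      omega
    · intro a ha
      simp only [Set.Finite.mem_toFinset, Set.mem_ofPred_eq] at ha ⊢
      by_cases hlt : J.depth ξ a ≤ n
      · left
        intro b hb
        rcases (adj_iff_children hlf ξ).1 hb with h | ⟨h, rfl⟩
        · rw [depth_child hlf h]
          omega
        · have := J.depth_parent h
          omega
      · right
        have hne : a ≠ ξ := by
          rintro rfl
          simp [J.depth_self] at hlt
        refine ⟨J.parent ξ a, ⟨(J.adj_parent hne).symm, ?_⟩, ?_⟩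
        · have := J.depth_parent hne
          omega
        · rintro b ⟨hb, hbd⟩
          rcases (adj_iff_children hlf ξ).1 hb with h | ⟨-, h⟩
          · rw [depth_child hlf h] at hbd
            omega
          · exact h.symm
    · simp [J.depth_self]
    · intro b hb
      simp only [Set.Finite.mem_toFinset, Set.mem_ofPred_eq]
      rcases (adj_iff_children hlf ξ).1 hb with h | ⟨h, -⟩
      · rw [depth_child hlf h, J.depth_self]
        omega
      · exact absurd rfl h⟩

lemma exists_subset_levelSubtree (hlf : J.IsLocallyFinite) (ξ : V) (s : Finset V) :
    ∃ n, s ⊆ (levelSubtree hlf ξ n).1 :=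
  ⟨s.sup (J.depth ξ), fun v hv => by
    have : J.depth ξ v ≤ _ := Finset.le_sup hv
    simp only [levelSubtree, Set.Finite.mem_toFinset, Set.mem_ofPred_eq]
    omega⟩

lemma nonempty_completeSubtree (hlf : J.IsLocallyFinite) (ξ : V) :
    Nonempty (J.CompleteSubtree ξ) := ⟨levelSubtree hlf ξ 0⟩

lemma isDirectedOrder_completeSubtree (hlf : J.IsLocallyFinite) (ξ : V) :
    IsDirectedOrder (J.CompleteSubtree ξ) := ⟨fun R R' => by
  classical
  obtain ⟨n, hn⟩ := exists_subset_levelSubtree hlf ξ (R.1 ∪ R'.1)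
  exact ⟨levelSubtree hlf ξ n, Finset.union_subset_left hn, Finset.union_subset_right hn⟩⟩

lemma tendsto_coe_completeSubtree (hlf : J.IsLocallyFinite) (ξ : V) :
    Tendsto (fun R : J.CompleteSubtree ξ => R.1) atTop atTop := by
  have := nonempty_completeSubtree hlf ξ
  have := isDirectedOrder_completeSubtree hlf ξ
  refine tendsto_atTop_atTop.2 fun s => ?_
  obtain ⟨n, hn⟩ := exists_subset_levelSubtree hlf ξ s
  exact ⟨levelSubtree hlf ξ n, fun R hR => hn.trans hR⟩

/-! ### The space `E_λ(J)` inside `ℓ²` -/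

/-- `E_λ(J)` consists of the charges whose weighted values on the balls are square summable. -/
lemma mem_chargeSpace_iff (hlf : J.IsLocallyFinite) (hperf : J.IsPerfect) (h0 : 0 < lam)
    {μ : SignedMeasure J.Abs} : μ ∈ J.chargeSpace ξ lam ↔
      Memℓp (fun v => J.coef ξ lam v * μ (J.ball ξ v)) 2 := by
  classical
  constructor
  · rintro ⟨C, hC⟩
    refine memℓp_gen' (C := C ^ (2 : ENNReal).toReal) fun s => ?_
    obtain ⟨n, hn⟩ := exists_subset_levelSubtree hlf ξ s
    have h1 := lp.sum_rpow_le_norm_rpow (p := 2) (by simp)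
      (J.psiOn ξ lam (levelSubtree hlf ξ n) μ : lp (fun _ : V => ℝ) 2) s
    refine le_trans (le_of_eq ?_) (h1.trans ?_)
    · refine Finset.sum_congr rfl fun v hv => ?_
      rw [psiOn_apply hlf hperf h0, if_pos (hn hv)]
    · exact Real.rpow_le_rpow (norm_nonneg _) (hC _) (by simp)
  · intro h
    let x : lp (fun _ : V => ℝ) 2 := ⟨_, h⟩
    refine ⟨‖x‖, fun R => ?_⟩
    refine lp.norm_mono (x := (J.psiOn ξ lam R μ : lp (fun _ : V => ℝ) 2)) (y := x) (by simp) ?_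
    intro v
    rw [psiOn_apply hlf hperf h0]
    split_ifs
    · rfl
    · simp

/-- The vector `Ψ[μ]`, as an element of `ℓ²`: its coordinates are the weighted values of `μ` on
the balls. -/
def embed (hlf : J.IsLocallyFinite) (hperf : J.IsPerfect) (ξ : V) (h0 : 0 < lam) :
    J.ESpace ξ lam →ₗ[ℝ] lp (fun _ : V => ℝ) 2 where
  toFun μ := ⟨fun v => J.coef ξ lam v * J.toCharge μ (J.ball ξ v),
    (mem_chargeSpace_iff hlf hperf h0).1 μ.2⟩
  map_add' μ ν := by
    ext v
    change J.coef ξ lam v * J.toCharge (μ + ν) (J.ball ξ v) =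
      J.coef ξ lam v * J.toCharge μ (J.ball ξ v) + J.coef ξ lam v * J.toCharge ν (J.ball ξ v)
    rw [← mul_add, map_add, _root_.add_apply]
  map_smul' c μ := by
    ext v
    change J.coef ξ lam v * J.toCharge (c • μ) (J.ball ξ v) =
      c * (J.coef ξ lam v * J.toCharge μ (J.ball ξ v))
    rw [map_smul, _root_.smul_apply, smul_eq_mul, mul_left_comm]

variable {hlf : J.IsLocallyFinite} {hperf : J.IsPerfect} {h0 : 0 < lam}

lemma embed_apply (μ : J.ESpace ξ lam) (v : V) :
    embed hlf hperf ξ h0 μ v = J.coef ξ lam v * J.toCharge μ (J.ball ξ v) := rfl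

lemma embed_injective [Countable V] (h1 : lam < 1) :
    Function.Injective (embed hlf hperf ξ h0) := by
  intro μ ν h
  refine Subtype.ext (charge_ext hlf ξ 0 fun v _ => ?_)
  have := congrArg (fun x : lp (fun _ : V => ℝ) 2 => x v) h
  simp only [embed_apply] at this
  exact mul_left_cancel₀ (J.coef_pos h0 h1 v).ne' this

/-- `Ψ[μ|R]` is the truncation to `R` of the vector `embed μ`, which therefore is the limit. -/
lemma coe_psi (μ : J.ESpace ξ lam) :
    (J.psi ξ lam μ : lp (fun _ : V => ℝ) 2) = embed hlf hperf ξ h0 μ := by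
  classical
  have hsum : ∀ R : J.CompleteSubtree ξ,
      (J.psiOn ξ lam R (J.toCharge μ) : lp (fun _ : V => ℝ) 2) =
        ∑ v ∈ R.1, lp.single (E := fun _ : V => ℝ) 2 v (embed hlf hperf ξ h0 μ v) := by
    intro R
    ext v
    rw [psiOn_apply hlf hperf h0, lp.coeFn_sum, Finset.sum_apply]
    simp [Pi.single_apply, embed_apply]
  have hlim : Tendsto (fun R : J.CompleteSubtree ξ =>
      (J.psiOn ξ lam R (J.toCharge μ) : lp (fun _ : V => ℝ) 2)) atTop
      (𝓝 (embed hlf hperf ξ h0 μ)) := by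
    simp only [hsum]
    have hs := lp.hasSum_single (p := 2) (by simp) (embed hlf hperf ξ h0 μ)
    rw [HasSum, SummationFilter.unconditional_filter] at hs
    exact hs.comp (tendsto_coe_completeSubtree hlf ξ)
  have := nonempty_completeSubtree hlf ξ
  have := isDirectedOrder_completeSubtree hlf ξ
  have hmem : embed hlf hperf ξ h0 μ ∈ J.HSpace ξ lam :=
    (Submodule.isClosed_topologicalClosure _).mem_of_tendsto hlim
      (Eventually.of_forall fun R => (J.psiOn ξ lam R (J.toCharge μ)).2)
  have hlim' : Tendsto (fun R : J.CompleteSubtree ξ => J.psiOn ξ lam R (J.toCharge μ)) atTop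
      (𝓝 ⟨_, hmem⟩) := tendsto_subtype_rng.2 hlim
  rw [psi, hlim'.limUnder_eq]

lemma innerE_eq (hlf : J.IsLocallyFinite) (hperf : J.IsPerfect) (h0 : 0 < lam)
    (μ ν : J.ESpace ξ lam) : J.innerE ξ lam μ ν =
      inner ℝ (embed hlf hperf ξ h0 μ) (embed hlf hperf ξ h0 ν) := by
  rw [innerE, Submodule.coe_inner, coe_psi (hlf := hlf) (hperf := hperf) (h0 := h0), coe_psi]

lemma normE_eq (hlf : J.IsLocallyFinite) (hperf : J.IsPerfect) (h0 : 0 < lam)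
    (μ : J.ESpace ξ lam) : J.normE ξ lam μ = ‖embed hlf hperf ξ h0 μ‖ := by
  rw [normE, ← Submodule.norm_coe, coe_psi (hlf := hlf) (hperf := hperf) (h0 := h0)]

end Embedding

section SquareSummableFlow

variable {V : Type*} {J : MetricTree V} {hlf : J.IsLocallyFinite} {hperf : J.IsPerfect} {ξ : V}
  {lam : ℝ} {h0 : 0 < lam}

/-! ### Square summable flows -/

/-- The vectors of `ℓ²` which become flows after division by the weights `coef`. -/
def flowSpace (hlf : J.IsLocallyFinite) (ξ : V) (lam : ℝ) :
    Submodule ℝ (lp (fun _ : V => ℝ) 2) where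
  carrier := {x | IsFlow hlf ξ fun v => x v / J.coef ξ lam v}
  zero_mem' := fun v => by simp
  add_mem' := by
    intro x y hx hy v
    have h1 := hx v
    have h2 := hy v
    simp only [lp.coeFn_add, Pi.add_apply, add_div, Finset.sum_add_distrib] at h1 h2 ⊢
    rw [h1, h2]
  smul_mem' := by
    intro c x hx v
    have h1 := hx v
    simp only [lp.coeFn_smul, Pi.smul_apply, smul_eq_mul, mul_div_assoc, ← Finset.mul_sum] at h1 ⊢
    rw [h1]

/-- The square summable flows that vanish at the depths up to `n`. -/
def deepFlowSpace (hlf : J.IsLocallyFinite) (ξ : V) (lam : ℝ) (n : ℕ) :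
    Submodule ℝ (lp (fun _ : V => ℝ) 2) where
  carrier := {x | x ∈ flowSpace hlf ξ lam ∧ ∀ v, J.depth ξ v ≤ n → x v = 0}
  zero_mem' := ⟨Submodule.zero_mem _, fun v _ => rfl⟩
  add_mem' := by
    rintro x y ⟨hx, hx'⟩ ⟨hy, hy'⟩
    exact ⟨Submodule.add_mem _ hx hy, fun v hv => by simp [hx' v hv, hy' v hv]⟩
  smul_mem' := by
    rintro c x ⟨hx, hx'⟩
    exact ⟨Submodule.smul_mem _ c hx, fun v hv => by simp [hx' v hv]⟩

lemma continuous_eval (v : V) : Continuous fun x : lp (fun _ : V => ℝ) 2 => x v :=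
  (lp.evalCLM ℝ (fun _ : V => ℝ) 2 v).continuous

lemma isClosed_deepFlowSpace (n : ℕ) :
    IsClosed (deepFlowSpace hlf ξ lam n : Set (lp (fun _ : V => ℝ) 2)) := by
  have h1 : IsClosed {x : lp (fun _ : V => ℝ) 2 | IsFlow hlf ξ fun v => x v / J.coef ξ lam v} := by
    simp only [IsFlow, Set.ofPred_forall]
    refine isClosed_iInter fun v => isClosed_eq ((continuous_eval v).div_const _) ?_
    exact continuous_finsetSum _ fun c _ => (continuous_eval c).div_const _
  have h2 : IsClosed {x : lp (fun _ : V => ℝ) 2 | ∀ v, J.depth ξ v ≤ n → x v = 0} := by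
    simp only [Set.ofPred_forall]
    exact isClosed_iInter fun v => isClosed_iInter fun _ =>
      isClosed_eq (continuous_eval v) continuous_const
  exact h1.inter h2

/-- The square summable flows orthogonal to those that vanish at the depths up to `n`. -/
def equilibriumSpace (hlf : J.IsLocallyFinite) (ξ : V) (lam : ℝ) (n : ℕ) :
    Submodule ℝ (lp (fun _ : V => ℝ) 2) :=
  flowSpace hlf ξ lam ⊓ (deepFlowSpace hlf ξ lam n)ᗮ

/-- A vector of `equilibriumSpace` is determined by its finitely many coordinates at the depths up
to `n`. -/
lemma finiteDimensional_equilibriumSpace (n : ℕ) :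
    FiniteDimensional ℝ (equilibriumSpace hlf ξ lam n) := by
  have : Finite {v | J.depth ξ v ≤ n} := finite_depth_le hlf ξ n
  let L : equilibriumSpace hlf ξ lam n →ₗ[ℝ] ({v | J.depth ξ v ≤ n} → ℝ) :=
    { toFun := fun x v => (x : lp (fun _ : V => ℝ) 2) v.1
      map_add' := fun x y => rfl
      map_smul' := fun c x => rfl }
  refine Module.Finite.of_injective L ((injective_iff_map_eq_zero L).2 fun x hx => ?_)
  have hd : (x : lp (fun _ : V => ℝ) 2) ∈ deepFlowSpace hlf ξ lam n :=
    ⟨x.2.1, fun v hv => congrFun hx ⟨v, hv⟩⟩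
  exact Subtype.ext (inner_self_eq_zero.1 ((Submodule.mem_orthogonal _ _).1 x.2.2 _ hd))

/-- The square summable flows are the orthogonal sum of `deepFlowSpace` and `equilibriumSpace`. -/
lemma mem_deepFlowSpace_of_orthogonal {n : ℕ} {y : lp (fun _ : V => ℝ) 2}
    (hy : y ∈ flowSpace hlf ξ lam) (horth : y ∈ (equilibriumSpace hlf ξ lam n)ᗮ) :
    y ∈ deepFlowSpace hlf ξ lam n := by
  have hc : CompleteSpace (deepFlowSpace hlf ξ lam n) :=
    (isClosed_deepFlowSpace n).completeSpace_coe
  obtain ⟨a, ha, b, hb, rfl⟩ := (deepFlowSpace hlf ξ lam n).exists_add_mem_mem_orthogonal y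
  have hbf : b ∈ flowSpace hlf ξ lam := by
    have := Submodule.sub_mem _ hy ha.1
    rwa [add_sub_cancel_left] at this
  have h1 := (Submodule.mem_orthogonal _ _).1 horth b ⟨hbf, hb⟩
  rw [inner_add_right, Submodule.inner_left_of_mem_orthogonal ha hb, zero_add] at h1
  rw [inner_self_eq_zero.1 h1, add_zero]
  exact ha

open Classical in
/-- The restriction of a flow to the branch with root `b` violates the flow condition only at the
parent of `b`. -/
lemma sum_children_branch {h : V → ℝ} (hf : IsFlow hlf ξ h) {b : V} (hb : b ≠ ξ) (w : V) :
    (∑ d ∈ children hlf ξ w, if d ∈ J.outerBranch ξ b then h d else 0) =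
      (if w ∈ J.outerBranch ξ b then h w else 0) + if w = J.parent ξ b then h b else 0 := by
  by_cases hw : w ∈ J.outerBranch ξ b
  · have hne : w ≠ J.parent ξ b := by
      rintro rfl
      have := J.depth_le_of_mem_outer hw
      rw [J.depth_parent hb] at this
      omega
    rw [if_pos hw, if_neg hne, add_zero, hf w]
    exact Finset.sum_congr rfl fun d hd =>
      if_pos (J.outer_subset hw (child_mem_outer hlf hd))
  · rw [if_neg hw, zero_add]
    have hd : ∀ d ∈ children hlf ξ w, d ∈ J.outerBranch ξ b → d = b := by
      intro d hd hm
      obtain ⟨hdξ, rfl⟩ := (mem_children hlf).1 hd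
      rcases J.mem_outer_iff.1 hm with h | h
      · exact h
      · exact absurd h.2 hw
    split_ifs with hwb
    · have hbc : b ∈ children hlf ξ w := (mem_children hlf).2 ⟨hb, hwb.symm⟩
      rw [Finset.sum_eq_single_of_mem b hbc fun d h1 h2 => if_neg fun hm => h2 (hd d h1 hm),
        if_pos (J.mem_outer_self _ _)]
    · refine Finset.sum_eq_zero fun d h1 => if_neg fun hm => hwb ?_
      rw [← hd d h1 hm]
      exact ((mem_children hlf).1 h1).2.symm

/-- The values at siblings `b`, `c` of large depth of a flow in `equilibriumSpace` do not have
opposite signs. Otherwise a combination with positive coefficients of its restrictions to the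
branches of `b` and `c` is a flow that vanishes at their parent, but it is not orthogonal to the
given flow. -/
lemma mul_nonneg_of_mem_equilibriumSpace (h0 : 0 < lam) (h1 : lam < 1) {n : ℕ}
    {x : lp (fun _ : V => ℝ) 2} (hx : x ∈ equilibriumSpace hlf ξ lam n) {v : V}
    (hv : n ≤ J.depth ξ v) {b c : V} (hb : b ∈ children hlf ξ v) (hc : c ∈ children hlf ξ v) :
    0 ≤ (x b / J.coef ξ lam b) * (x c / J.coef ξ lam c) := by
  classical
  by_contra hneg
  rw [not_le] at hneg
  set h : V → ℝ := fun v => x v / J.coef ξ lam v with hh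
  change h b * h c < 0 at hneg
  have hhc : h c ≠ 0 := fun h => by simp [h] at hneg
  have hhb : h b ≠ 0 := fun h => by simp [h] at hneg
  have hbξ := (mem_children hlf).1 hb
  have hcξ := (mem_children hlf).1 hc
  -- `r` balances the restrictions at `v`: `h b + r * h c = 0`
  let r : ℝ := -h b / h c
  have hr : 0 < r := by
    have : r = -(h b * h c) / (h c * h c) := by
      simp only [r]
      field_simp
    rw [this]
    exact div_pos (neg_pos.2 hneg) (mul_self_pos.2 hhc)
  let q : V → ℝ := fun w => (if w ∈ J.outerBranch ξ b then 1 else 0) +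
    if w ∈ J.outerBranch ξ c then r else 0
  have hq : ∀ w, 0 ≤ q w := fun w => by
    simp only [q]
    split_ifs <;> linarith
  have hq1 : ∀ w, q w ≤ 1 + r := fun w => by
    simp only [q]
    split_ifs <;> linarith
  let k : lp (fun _ : V => ℝ) 2 := ⟨fun w => q w * x w, by
    refine memℓp_gen (Summable.of_nonneg_of_le (fun w => by positivity) (fun w => ?_)
      (((lp.memℓp x).const_smul (1 + r)).summable (by simp)))
    refine Real.rpow_le_rpow (norm_nonneg _) ?_ (by simp)
    rw [Pi.smul_apply, norm_smul, norm_mul, Real.norm_of_nonneg (hq w),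
      Real.norm_of_nonneg (show 0 ≤ 1 + r by linarith)]
    exact mul_le_mul_of_nonneg_right (hq1 w) (norm_nonneg _)⟩
  have hk : ∀ w, k w = q w * x w := fun w => rfl
  have hkd : k ∈ deepFlowSpace hlf ξ lam n := by
    refine ⟨fun w => ?_, fun w hw => ?_⟩
    · have e : ∀ w, k w / J.coef ξ lam w = (if w ∈ J.outerBranch ξ b then h w else 0) +
          r * if w ∈ J.outerBranch ξ c then h w else 0 := by
        intro w
        rw [hk, mul_div_assoc]
        change q w * h w = _
        simp only [q]
        split_ifs <;> ring
      simp only [e]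
      rw [Finset.sum_add_distrib, ← Finset.mul_sum, sum_children_branch hx.1 hbξ.1,
        sum_children_branch hx.1 hcξ.1, hbξ.2, hcξ.2]
      have : h b + r * h c = 0 := by
        simp only [r]
        field_simp
        ring
      split_ifs <;> linarith
    · have hout : ∀ d ∈ children hlf ξ v, w ∉ J.outerBranch ξ d := by
        intro d hd hm
        have := J.depth_le_of_mem_outer hm
        rw [depth_child hlf hd] at this
        omega
      rw [hk]
      simp [q, hout b hb, hout c hc]
  have horth := (Submodule.mem_orthogonal _ _).1 hx.2 k hkd
  have hterm : ∀ w, inner ℝ (k w : ℝ) (x w : ℝ) = q w * x w ^ 2 := by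
    intro w
    rw [hk]
    simp
    ring
  have hs : HasSum (fun w => inner ℝ (k w : ℝ) (x w : ℝ)) (inner ℝ k x) :=
    lp.hasSum_inner (G := fun _ : V => ℝ) k x
  rw [horth] at hs
  have hz := (hasSum_zero_iff_of_nonneg fun w => by
    simp only [hterm]
    exact mul_nonneg (hq w) (sq_nonneg _)).1 hs
  have hzb : inner ℝ (k b : ℝ) (x b : ℝ) = 0 := congrFun hz b
  rw [hterm] at hzb
  have hqb : 0 < q b := by
    simp only [q, if_pos (J.mem_outer_self ξ b)]
    split_ifs <;> linarith
  rcases mul_eq_zero.1 hzb with h2 | h2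
  · exact hqb.ne' h2
  · refine hhb ?_
    simp only [hh]
    rw [pow_eq_zero_iff two_ne_zero] at h2
    rw [h2, zero_div]

lemma embed_mem_flowSpace (h1 : lam < 1) (μ : J.ESpace ξ lam) :
    embed hlf hperf ξ h0 μ ∈ flowSpace hlf ξ lam := by
  have : (fun v => embed hlf hperf ξ h0 μ v / J.coef ξ lam v) =
      fun v => J.toCharge μ (J.ball ξ v) := by
    funext v
    rw [embed_apply, mul_div_cancel_left₀ _ (J.coef_pos h0 h1 v).ne']
  change IsFlow hlf ξ _
  rw [this]
  exact isFlow_charge hlf ξ _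

/-- The vectors of `equilibriumSpace` belong to genuine charges, although `E_λ(J)` need not be
complete. -/
lemma equilibriumSpace_le_range [Countable V] (h1 : lam < 1) (n : ℕ) :
    equilibriumSpace hlf ξ lam n ≤ LinearMap.range (embed hlf hperf ξ h0) := by
  intro x hx
  obtain ⟨μ, hμ⟩ := IsFlow.exists_charge (hlf := hlf) (ξ := ξ) hx.1 n fun v hv b hb c hc =>
    mul_nonneg_of_mem_equilibriumSpace h0 h1 hx hv hb hc
  have hx' : (fun v => J.coef ξ lam v * μ (J.ball ξ v)) = x := by
    funext v
    rw [hμ, mul_div_cancel₀ _ (J.coef_pos h0 h1 v).ne']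
  have hmem : μ ∈ J.chargeSpace ξ lam := by
    rw [mem_chargeSpace_iff hlf hperf h0, hx']
    exact lp.memℓp x
  exact ⟨⟨μ, hmem⟩, Subtype.ext hx'⟩

end SquareSummableFlow

section Hierarchomorphism

variable {V : Type*} {J : MetricTree V} {hlf : J.IsLocallyFinite} {hperf : J.IsPerfect} {ξ : V}
  {lam : ℝ} {h0 : 0 < lam}

/-! ### Hierarchomorphisms far from the root -/

/-- At depths at least `n`, the bijection `g` maps branches isometrically onto branches and
respects the relation between a vertex and its children. -/
structure RigidBeyond (hlf : J.IsLocallyFinite) (ξ : V) (g : Equiv.Perm V) (n : ℕ) : Prop where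
  mem_outer_iff : ∀ v, n ≤ J.depth ξ v → ∀ u,
    g u ∈ J.outerBranch ξ (g v) ↔ u ∈ J.outerBranch ξ v
  rho_eq : ∀ v, n ≤ J.depth ξ v → ∀ u ∈ J.outerBranch ξ v, J.rho (g v) (g u) = J.rho v u
  map_child : ∀ v, n ≤ J.depth ξ v → ∀ c ∈ children hlf ξ v, g c ∈ children hlf ξ (g v)

/-- A branch that contains neither an end of an edge between two of the subtrees `S j` nor the
preimage of `ξ` lies in one of the `S j`, and its image under the corresponding isometry does not
contain `ξ`. -/
lemma exists_rigidBeyond (hlf : J.IsLocallyFinite) (ξ : V) {Γ : Type*} [Group Γ] [MulAction Γ V]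
    (hΓ : J.ActsByIsometries Γ) {g : Equiv.Perm V} (hg : g ∈ J.HierCirc Γ) :
    ∃ n, RigidBeyond hlf ξ g n := by
  obtain ⟨k, S, γ, hright, -, hcover, hgγ⟩ := hg
  have hfin : (⋃ j, J.cutEdges (S j)).Finite := Set.finite_iUnion fun j => (hright j).2
  obtain ⟨n, hn⟩ : ∃ n, ∀ p ∈ ⋃ j, J.cutEdges (S j), J.depth ξ p.2 < n := by
    obtain ⟨m, hm⟩ := (hfin.image fun p => J.depth ξ p.2).bddAbove
    exact ⟨m + 1, fun p hp => Nat.lt_succ_of_le (hm ⟨p, hp, rfl⟩)⟩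
  let N := max n (J.depth ξ (g.symm ξ) + 1)
  have hpiece : ∀ v, N ≤ J.depth ξ v → ∃ γ : Γ, ∀ u ∈ J.outerBranch ξ v, g u = γ • u := by
    intro v hv
    obtain ⟨j, hj⟩ := Set.mem_iUnion.1 (hcover ▸ Set.mem_univ v)
    refine ⟨γ j, fun u hu => hgγ j u ?_⟩
    refine J.outer_induction (P := fun u => u ∈ S j) hj (fun u hu _ hp ih => ?_) hu
    by_contra hnot
    have h1 := hn (J.parent ξ u, u) (Set.mem_iUnion.2 ⟨j, J.adj_parent hu, ih, hnot⟩)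
    have h2 := J.depth_le_of_mem_outer (J.mem_outer_of_parent hu hp)
    have h3 : n ≤ N := le_max_left _ _
    simp only at h1
    omega
  have hmem : ∀ v, N ≤ J.depth ξ v → ∀ u,
      g u ∈ J.outerBranch ξ (g v) ↔ u ∈ J.outerBranch ξ v := by
    intro v hv
    obtain ⟨γ, hγ⟩ := hpiece v hv
    -- `γ⁻¹ξ` in the branch would be `g⁻¹ξ`, whose depth is too small
    have hξ : γ⁻¹ • ξ ∉ J.outerBranch ξ v := by
      intro hm
      have h1 : γ⁻¹ • ξ = g.symm ξ := by
        rw [Equiv.eq_symm_apply, hγ _ hm, smul_inv_smul]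
      have h2 := J.depth_le_of_mem_outer hm
      have h3 : J.depth ξ (g.symm ξ) + 1 ≤ N := le_max_right _ _
      rw [h1] at h2
      omega
    have htrans : ∀ u, γ • u ∈ J.outerBranch ξ (γ • v) ↔
        v ∈ (J.path (γ⁻¹ • ξ) u).support := by
      intro u
      rw [← smul_mem_path_iff hΓ γ, smul_inv_smul, mem_outer_iff_support]
    have hv' : g v = γ • v := hγ v (J.mem_outer_self _ _)
    intro u
    constructor
    · intro hu
      have h1 := (htrans (γ⁻¹ • g u)).1 (by rwa [smul_inv_smul, ← hv'])
      have h2 := J.path_support_subset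
        ((J.path ξ (γ⁻¹ • ξ)).reverse.append (J.path ξ (γ⁻¹ • g u))) h1
      rw [SimpleGraph.Walk.mem_support_append_iff, SimpleGraph.Walk.support_reverse,
        List.mem_reverse] at h2
      have h3 : γ⁻¹ • g u ∈ J.outerBranch ξ v := h2.resolve_left hξ
      have h4 := hγ _ h3
      rw [smul_inv_smul] at h4
      rwa [← g.injective h4]
    · intro hu
      rw [hv', hγ u hu, htrans]
      have h2 := J.path_support_subset
        ((J.path ξ (γ⁻¹ • ξ)).append (J.path (γ⁻¹ • ξ) u)) (J.mem_outer_iff_support.1 hu)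
      rw [SimpleGraph.Walk.mem_support_append_iff] at h2
      exact h2.resolve_left hξ
  refine ⟨N, hmem, fun v hv u hu => ?_, fun v hv c hc => ?_⟩
  · obtain ⟨γ, hγ⟩ := hpiece v hv
    rw [hγ u hu, hγ v (J.mem_outer_self _ _), hΓ γ]
  · obtain ⟨γ, hγ⟩ := hpiece v hv
    have hcv := child_mem_outer hlf hc
    have hadj : J.graph.Adj (g v) (g c) := by
      rw [hγ c hcv, hγ v (J.mem_outer_self _ _), smul_adj_iff hΓ]
      exact (adj_iff_children hlf ξ).2 (Or.inl hc)
    refine ((adj_iff_children hlf ξ).1 hadj).resolve_right ?_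
    rintro ⟨h1, h2⟩
    have h3 := J.depth_le_of_mem_outer ((hmem v hv c).2 hcv)
    rw [J.depth_parent h1, h2] at h3
    omega

/-- All but finitely many vertices are images of vertices of depth at least `n`. -/
lemma exists_depth_symm (hlf : J.IsLocallyFinite) (ξ : V) (g : Equiv.Perm V)
    (n : ℕ) : ∃ m, ∀ w, m ≤ J.depth ξ w → n ≤ J.depth ξ (g.symm w) := by
  obtain ⟨m, hm⟩ := ((finite_depth_le hlf ξ n).image fun v => J.depth ξ (g v)).bddAbove
  refine ⟨m + 1, fun w hw => ?_⟩
  by_contra hlt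
  have := hm ⟨g.symm w, (not_le.1 hlt).le, rfl⟩
  simp only [Equiv.apply_symm_apply] at this
  omega

namespace RigidBeyond

variable {g : Equiv.Perm V} {n : ℕ} {φ : Equiv.Perm J.Abs}

/-- The constant value of `ρ(ξ,u) - ρ(ξ,gu)` on the branch with root `v`. -/
lemma rho_sub_eq (hr : RigidBeyond hlf ξ g n) {u v : V} (hv : n ≤ J.depth ξ v)
    (hu : u ∈ J.outerBranch ξ v) :
    J.rho ξ u - J.rho ξ (g u) = J.rho ξ v - J.rho ξ (g v) := by
  rw [J.rho_eq_add_of_mem (J.mem_outer_iff_support.1 hu),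
    J.rho_eq_add_of_mem (J.mem_outer_iff_support.1 ((hr.mem_outer_iff v hv u).2 hu)),
    hr.rho_eq v hv u hu]
  ring

lemma apply_mem_ball_iff (hr : RigidBeyond hlf ξ g n) (hφ : J.Induces g φ) {v : V}
    (hv : n ≤ J.depth ξ v) {ω : J.Abs} : φ ω ∈ J.ball ξ (g v) ↔ ω ∈ J.ball ξ v := by
  obtain ⟨a, rfl⟩ := exists_ray ω
  obtain ⟨N, b, hb, hφb⟩ := hφ a
  rw [hφb, ← a.toAbs_tail N, toAbs_mem_ends_iff, toAbs_mem_ends_iff]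
  refine eventually_congr (Eventually.of_forall fun i => ?_)
  rw [hb]
  exact hr.mem_outer_iff v hv _

lemma pseudoderivative_eq (hr : RigidBeyond hlf ξ g n) {v : V} (hv : n ≤ J.depth ξ v)
    {ω : J.Abs} (hω : ω ∈ J.ball ξ v) :
    J.pseudoderivative ξ g ω = J.rho ξ v - J.rho ξ (g v) := by
  obtain ⟨a, rfl⟩ := exists_ray ω
  change limUnder atTop (fun M => J.rho ξ (a.1 M) - J.rho ξ (g (a.1 M))) = _
  refine Tendsto.limUnder_eq (tendsto_const_nhds.congr' ?_)
  filter_upwards [toAbs_mem_ends_iff.1 hω] with M hM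
  exact (hr.rho_sub_eq hv hM).symm

lemma measurable_symm [Countable V] (hr : RigidBeyond hlf ξ g n) (hφ : J.Induces g φ) :
    Measurable φ.symm := by
  refine Measurable.mono (measurable_generateFrom ?_) le_rfl
    (measurableSpace_eq_generateFrom_deep_balls hlf ξ n).le
  rintro _ ⟨v, hv, rfl⟩
  have : φ.symm ⁻¹' J.ball ξ v = J.ball ξ (g v) := by
    ext ω
    rw [Set.mem_preimage, ← hr.apply_mem_ball_iff hφ hv, Equiv.apply_symm_apply]
  rw [this]
  exact measurableSet_ball _ _

lemma measurable [Countable V] (hr : RigidBeyond hlf ξ g n) (hφ : J.Induces g φ) :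
    Measurable φ := by
  obtain ⟨m, hm⟩ := exists_depth_symm hlf ξ g n
  refine Measurable.mono (measurable_generateFrom ?_) le_rfl
    (measurableSpace_eq_generateFrom_deep_balls hlf ξ m).le
  rintro _ ⟨w, hw, rfl⟩
  have : φ ⁻¹' J.ball ξ w = J.ball ξ (g.symm w) := by
    ext ω
    rw [Set.mem_preimage, ← hr.apply_mem_ball_iff hφ (hm w hw), Equiv.apply_symm_apply]
  rw [this]
  exact measurableSet_ball _ _

/-- At large depths, the change of the weights under `g` is compensated by the density of
`T_λ(g)`. -/
lemma coef_mul (hr : RigidBeyond hlf ξ g n) (h0 : 0 < lam) (h1 : lam < 1) {c : V}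
    (hc : n + 1 ≤ J.depth ξ c) :
    J.coef ξ lam c * lam ^ (J.rho ξ c - J.rho ξ (g c)) = J.coef ξ lam (g c) := by
  have hcξ : c ≠ ξ := by
    rintro rfl
    simp [J.depth_self] at hc
  have hp : n ≤ J.depth ξ (J.parent ξ c) := by
    rw [J.depth_parent hcξ] at hc
    omega
  have hmem : c ∈ children hlf ξ (J.parent ξ c) := (mem_children hlf).2 ⟨hcξ, rfl⟩
  obtain ⟨hgc, hgp⟩ := (mem_children hlf).1 (hr.map_child _ hp c hmem)
  have hs := hr.rho_sub_eq hp (child_mem_outer hlf hmem)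
  refine (sq_eq_sq₀ (mul_pos (J.coef_pos h0 h1 c) (Real.rpow_pos_of_pos h0 _)).le
    (J.coef_pos h0 h1 _).le).1 ?_
  rw [mul_pow, J.coef_sq h0 h1 hcξ, J.coef_sq h0 h1 hgc, hgp, sub_mul, ← Real.rpow_natCast,
    ← Real.rpow_mul h0.le, ← Real.rpow_add h0, ← Real.rpow_add h0]
  congr 2
  · push_cast
    ring
  · rw [hs]
    push_cast
    ring

end RigidBeyond

/-! ### Charges with a locally constant density -/

/-- If the density is constant on the balls of depth at least `n`, it takes finitely many values, so
it is integrable. -/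
lemma withDensity_ball {n : ℕ} {f : J.Abs → ℝ} {c : V → ℝ} (hlf : J.IsLocallyFinite)
    (hf : ∀ v, n ≤ J.depth ξ v → ∀ ω ∈ J.ball ξ v, f ω = c v) (μ : SignedMeasure J.Abs) {v : V}
    (hv : n ≤ J.depth ξ v) :
    μ.withDensity f (ContinuousLinearMap.lsmul ℝ ℝ) (J.ball ξ v) = c v * μ (J.ball ξ v) := by
  have hfinite : IsFiniteMeasure μ.variation := by
    rw [← SignedMeasure.totalVariation_eq_variation]
    infer_instance
  have hfsum : f = fun ω => ∑ v ∈ (finite_depth_le hlf ξ n).toFinset.filter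
      (fun v => J.depth ξ v = n), (J.ball ξ v).indicator (fun _ => c v) ω := by
    funext ω
    obtain ⟨u, hu, hω⟩ := exists_mem_ball ξ n ω
    rw [Finset.sum_eq_single_of_mem u (by simp [hu]), Set.indicator_of_mem hω, hf u hu.ge ω hω]
    intro w hw hne
    refine Set.indicator_of_notMem (fun hm => ?_) _
    exact Set.disjoint_left.1 (disjoint_ball_of_depth_eq
      ((Finset.mem_filter.1 hw).2.trans hu.symm) hne) hm hω
  have hint : μ.Integrable f := by
    rw [hfsum]
    exact integrable_finsetSum _ fun v _ =>
      (integrable_const (c v)).indicator (measurableSet_ball ξ v)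
  rw [VectorMeasure.withDensity_apply hint, VectorMeasure.setIntegral_congr_fun
    (g := fun _ => c v) (hf v hv), VectorMeasure.setIntegral_const]
  simp

/-! ### The operator `T_λ(g)` -/

lemma memℓp_iff_of_perm {g : Equiv.Perm V} {x y : V → ℝ} (hfin : {v | y v ≠ x (g v)}.Finite) :
    Memℓp y 2 ↔ Memℓp x 2 := by
  have h2 : 0 < (2 : ENNReal).toReal := by simp
  rw [memℓp_gen_iff h2, memℓp_gen_iff h2,
    ← g.summable_iff (f := fun i => ‖x i‖ ^ (2 : ENNReal).toReal)]
  refine summable_congr_cofinite ?_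
  filter_upwards [hfin.compl_mem_cofinite] with v hv
  rw [Function.comp_apply, not_not.1 hv]

lemma finite_coef_ne {g : Equiv.Perm V} {n : ℕ} (hr : RigidBeyond hlf ξ g n) (h0 : 0 < lam)
    (h1 : lam < 1)
    {μ ν : SignedMeasure J.Abs} (hμν : ∀ v, n ≤ J.depth ξ v → ν (J.ball ξ v) =
      lam ^ (J.rho ξ v - J.rho ξ (g v)) * μ (J.ball ξ (g v))) :
    {v | J.coef ξ lam v * ν (J.ball ξ v) ≠ J.coef ξ lam (g v) * μ (J.ball ξ (g v))}.Finite := by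
  refine (finite_depth_le hlf ξ n).subset fun v hv => ?_
  by_contra hn
  simp only [Set.mem_ofPred_eq, not_le] at hn
  refine hv ?_
  rw [hμν v hn.le, ← mul_assoc, hr.coef_mul h0 h1 hn]

lemma mem_chargeSpace_iff_of_ball (hperf : J.IsPerfect)
    {g : Equiv.Perm V} {n : ℕ} (hr : RigidBeyond hlf ξ g n)
    (h0 : 0 < lam) (h1 : lam < 1)
    {μ ν : SignedMeasure J.Abs} (hμν : ∀ v, n ≤ J.depth ξ v → ν (J.ball ξ v) =
      lam ^ (J.rho ξ v - J.rho ξ (g v)) * μ (J.ball ξ (g v))) :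
    ν ∈ J.chargeSpace ξ lam ↔ μ ∈ J.chargeSpace ξ lam := by
  rw [mem_chargeSpace_iff hlf hperf h0, mem_chargeSpace_iff hlf hperf h0]
  exact memℓp_iff_of_perm (x := fun v => J.coef ξ lam v * μ (J.ball ξ v))
    (finite_coef_ne hr h0 h1 hμν)

section Operator

variable [Countable V] {g : Equiv.Perm V} {n : ℕ} {φ : Equiv.Perm J.Abs}

lemma boundaryOp_ball (hr : RigidBeyond hlf ξ g n) (hφ : J.Induces g φ)
    (μ : SignedMeasure J.Abs) {v : V} (hv : n ≤ J.depth ξ v) :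
    J.boundaryOp ξ lam g φ μ (J.ball ξ v) =
      lam ^ (J.rho ξ v - J.rho ξ (g v)) * μ (J.ball ξ (g v)) := by
  rw [boundaryOp, withDensity_ball (c := fun v => lam ^ (J.rho ξ v - J.rho ξ (g v))) hlf
    (fun v hv ω hω => by rw [hr.pseudoderivative_eq hv hω]) _ hv,
    VectorMeasure.map_apply _ (hr.measurable_symm hφ) (measurableSet_ball ξ v)]
  congr 2
  ext ω
  rw [Set.mem_preimage, ← hr.apply_mem_ball_iff hφ hv, Equiv.apply_symm_apply]

/-- The formula for the values of `T_λ(g) μ` on small balls can be solved for `μ`. -/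
lemma exists_charge_preimage (hr : RigidBeyond hlf ξ g n) (hφ : J.Induces g φ)
    (ν : SignedMeasure J.Abs) : ∃ μ : SignedMeasure J.Abs, ∀ v, n ≤ J.depth ξ v →
      μ (J.ball ξ (g v)) = lam ^ (-(J.rho ξ v - J.rho ξ (g v))) * ν (J.ball ξ v) := by
  refine ⟨(ν.withDensity (fun ω => lam ^ (-J.pseudoderivative ξ g ω))
    (ContinuousLinearMap.lsmul ℝ ℝ)).map φ, fun v hv => ?_⟩
  have hpre : φ ⁻¹' J.ball ξ (g v) = J.ball ξ v := by
    ext ω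
    exact hr.apply_mem_ball_iff hφ hv
  rw [VectorMeasure.map_apply _ (hr.measurable hφ) (measurableSet_ball ξ _), hpre,
    withDensity_ball (c := fun v => lam ^ (-(J.rho ξ v - J.rho ξ (g v)))) hlf
    (fun v hv ω hω => by rw [hr.pseudoderivative_eq hv hω]) _ hv]

/-- The operator `T_λ(g)` in `E_λ(J)`. -/
def boundaryMap (hperf : J.IsPerfect) (hr : RigidBeyond hlf ξ g n) (hφ : J.Induces g φ)
    (h0 : 0 < lam) (h1 : lam < 1) : J.ESpace ξ lam →ₗ[ℝ] J.ESpace ξ lam where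
  toFun μ := ⟨J.boundaryOp ξ lam g φ (J.toCharge μ),
    (mem_chargeSpace_iff_of_ball hperf hr h0 h1 fun _ hv => boundaryOp_ball hr hφ _ hv).2 μ.2⟩
  map_add' μ ν := by
    refine Subtype.ext (charge_ext hlf ξ n fun v hv => ?_)
    change J.boundaryOp ξ lam g φ (J.toCharge μ + J.toCharge ν) (J.ball ξ v) =
      (J.boundaryOp ξ lam g φ (J.toCharge μ) + J.boundaryOp ξ lam g φ (J.toCharge ν)) (J.ball ξ v)
    rw [_root_.add_apply, boundaryOp_ball hr hφ _ hv, boundaryOp_ball hr hφ _ hv,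
      boundaryOp_ball hr hφ _ hv, _root_.add_apply, mul_add]
  map_smul' c μ := by
    refine Subtype.ext (charge_ext hlf ξ n fun v hv => ?_)
    change J.boundaryOp ξ lam g φ (c • J.toCharge μ) (J.ball ξ v) =
      (c • J.boundaryOp ξ lam g φ (J.toCharge μ)) (J.ball ξ v)
    rw [_root_.smul_apply, boundaryOp_ball hr hφ _ hv, boundaryOp_ball hr hφ _ hv,
      _root_.smul_apply, smul_eq_mul, smul_eq_mul, mul_left_comm]

variable (hr : RigidBeyond hlf ξ g n) (hφ : J.Induces g φ) (h0 : 0 < lam) (h1 : lam < 1)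

lemma toCharge_boundaryMap (μ : J.ESpace ξ lam) :
    J.toCharge (boundaryMap hperf hr hφ h0 h1 μ) = J.boundaryOp ξ lam g φ (J.toCharge μ) := rfl

lemma boundaryMap_bijective : Function.Bijective (boundaryMap hperf hr hφ h0 h1) := by
  constructor
  · intro μ ν h
    obtain ⟨m, hm⟩ := exists_depth_symm hlf ξ g n
    refine Subtype.ext (charge_ext hlf ξ m fun w hw => ?_)
    have h2 := congrArg (fun μ => J.toCharge μ (J.ball ξ (g.symm w))) h
    simp only [toCharge_boundaryMap] at h2
    rw [boundaryOp_ball hr hφ _ (hm w hw), boundaryOp_ball hr hφ _ (hm w hw),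
      Equiv.apply_symm_apply] at h2
    exact mul_left_cancel₀ (Real.rpow_pos_of_pos h0 _).ne' h2
  · intro ν
    obtain ⟨μ, hμ⟩ := exists_charge_preimage (lam := lam) hr hφ (J.toCharge ν)
    have hν : ∀ v, n ≤ J.depth ξ v → J.toCharge ν (J.ball ξ v) =
        lam ^ (J.rho ξ v - J.rho ξ (g v)) * μ (J.ball ξ (g v)) := by
      intro v hv
      rw [hμ v hv, ← mul_assoc, ← Real.rpow_add h0, add_neg_cancel, Real.rpow_zero, one_mul]
    refine ⟨⟨μ, (mem_chargeSpace_iff_of_ball hperf hr h0 h1 hν).1 ν.2⟩, ?_⟩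
    refine Subtype.ext (charge_ext hlf ξ n fun v hv => ?_)
    exact (boundaryOp_ball hr hφ μ hv).trans (hν v hv).symm

lemma embed_boundaryMap (μ : J.ESpace ξ lam) {v : V} (hv : n + 1 ≤ J.depth ξ v) :
    embed hlf hperf ξ h0 (boundaryMap hperf hr hφ h0 h1 μ) v =
      embed hlf hperf ξ h0 μ (g v) := by
  rw [embed_apply, embed_apply, toCharge_boundaryMap, boundaryOp_ball hr hφ _ (by omega),
    ← mul_assoc, hr.coef_mul h0 h1 hv]

/-- `T_λ(g)` preserves the inner products with the charges which vanish on the large balls. -/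
lemma inner_embed_boundaryMap {m : ℕ} (hm : ∀ v, J.depth ξ v ≤ n + 1 → J.depth ξ (g v) ≤ m)
    {μ : J.ESpace ξ lam} (hμ : embed hlf hperf ξ h0 μ ∈ deepFlowSpace hlf ξ lam m)
    (ν : J.ESpace ξ lam) :
    inner ℝ (embed hlf hperf ξ h0 (boundaryMap hperf hr hφ h0 h1 μ))
      (embed hlf hperf ξ h0 (boundaryMap hperf hr hφ h0 h1 ν)) =
      inner ℝ (embed hlf hperf ξ h0 μ) (embed hlf hperf ξ h0 ν) := by
  have hflow := embed_mem_flowSpace (hperf := hperf) (h0 := h0) (hlf := hlf) h1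
    (boundaryMap hperf hr hφ h0 h1 μ)
  have hzero : ∀ v, J.depth ξ v ≤ n + 1 →
      embed hlf hperf ξ h0 (boundaryMap hperf hr hφ h0 h1 μ) v = 0 := by
    intro v hv
    have h2 := IsFlow.eq_zero_of_le hflow (n := n + 1) (fun u hu => by
      rw [embed_boundaryMap hr hφ h0 h1 μ hu.ge, hμ.2 _ (hm u hu.le), zero_div]) hv
    exact (div_eq_zero_iff.1 h2).resolve_right (J.coef_pos h0 h1 v).ne'
  rw [lp.inner_eq_tsum, lp.inner_eq_tsum, ← g.tsum_eq fun w =>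
    inner ℝ (embed hlf hperf ξ h0 μ w : ℝ) (embed hlf hperf ξ h0 ν w : ℝ)]
  refine tsum_congr fun v => ?_
  by_cases hv : J.depth ξ v ≤ n + 1
  · rw [hzero v hv, hμ.2 _ (hm v hv), inner_zero_left, inner_zero_left]
  · rw [embed_boundaryMap hr hφ h0 h1 μ (by omega), embed_boundaryMap hr hφ h0 h1 ν (by omega)]

end Operator

end Hierarchomorphism

end

end MetricTree

theorem theorem6p2 {V : Type*} [Countable V] (J : MetricTree V)
    (hperf : J.IsPerfect) (hlf : J.IsLocallyFinite)
    {Γ : Type*} [Group Γ] [MulAction Γ V] (hΓ : J.ActsByIsometries Γ)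
    (ξ : V) (lam : ℝ) (h0 : 0 < lam) (h1 : lam < 1)
    (φ : Equiv.Perm J.Abs) (hφ : φ ∈ J.Hier Γ) :
    ∀ g ∈ J.HierCirc Γ, J.Induces g φ →
      ∃ (A : J.ESpace ξ lam ≃ₗ[ℝ] J.ESpace ξ lam) (Q : J.ESpace ξ lam →ₗ[ℝ] J.ESpace ξ lam),
        J.IsOrthogonalOp A ∧ J.IsFiniteRankOp Q ∧
        ∀ μ : J.ESpace ξ lam,
          J.boundaryOp ξ lam g φ (J.toCharge μ) = J.toCharge (A (μ + Q μ)) := by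
  intro g hg hind
  obtain ⟨n, hr⟩ := MetricTree.exists_rigidBeyond hlf ξ hΓ hg
  obtain ⟨m, hm⟩ := ((MetricTree.finite_depth_le hlf ξ (n + 1)).image
    fun v => J.depth ξ (g v)).bddAbove
  -- `m` bounds the depths of the images of all vertices of depth at most `n + 1`
  let T := LinearEquiv.ofBijective _
    (MetricTree.boundaryMap_bijective (hperf := hperf) hr hind h0 h1)
  have hfin : FiniteDimensional ℝ (MetricTree.equilibriumSpace hlf ξ lam m) :=
    MetricTree.finiteDimensional_equilibriumSpace m
  obtain ⟨A, Q, hA, hQ, ⟨C, hC⟩, hT⟩ := exists_orthogonal_factor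
    (MetricTree.embed hlf hperf ξ h0) (MetricTree.embed_injective h1)
    (MetricTree.equilibriumSpace hlf ξ lam m) (MetricTree.equilibriumSpace_le_range h1 m) T
    (fun μ hμ ν => MetricTree.inner_embed_boundaryMap hr hind h0 h1 (fun v hv => hm ⟨v, hv, rfl⟩)
      (MetricTree.mem_deepFlowSpace_of_orthogonal (MetricTree.embed_mem_flowSpace h1 μ) hμ) ν)
  refine ⟨A, Q, fun μ ν => ?_, ⟨hQ, C, fun μ => ?_⟩, fun μ => ?_⟩
  · rw [MetricTree.innerE_eq hlf hperf h0, MetricTree.innerE_eq hlf hperf h0, hA]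
  · rw [MetricTree.normE_eq hlf hperf h0, MetricTree.normE_eq hlf hperf h0]
    exact hC μ
  · rw [← hT μ]
    rfl
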